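/- Let $\rho,c>0$ and let $F\in C^1(\mathbb R,\mathbb R)$ satisfy $F'\le 0$ on $\mathbb R$, $F(0)=0$, $F'(0)<0$, $\lim_{x\to+\infty}F(x)=-\infty$, $\lim_{x\to+\infty}F'(x)=-l$ for some $l>0$, and, for some $\bar x>0$, $F$ is convex on $[0,\bar x]$ and concave on $[\bar x,+\infty)$. Fix $x_0\ge 0$. Let $\Lambda=\{u\in L^1_{loc}([0,+\infty)) : u>0 \text{ a.e.}\}$; for $u\in\Lambda$ let $x(\cdot;x_0,u)$ be the (Carathéodory) solution of $\dot x=F(x)+u$, $x(0)=x_0$ on $[0,+\infty)$, and put $$\mathcal B(u)=\int_0^{+\infty}e^{-\rho t}\bigl(\log u(t)-c\,x(t;x_0,u)^2\bigr)\,dt\in[-\infty,+\infty],\qquad V=\sup_{u\in\Lambda}\mathcal B(u).$$ A sequence $(u_n)$ in $\Lambda$ is maximizing if $\mathcal B(u_n)\to V$; a control $u\in\Lambda$ is optimal if its integrand $e^{-\rho t}(\log u-c\,x^2)$ is integrable and $\mathcal B(u)=V$. A pair of functions $N,\eta:[0,+\infty)\to(0,+\infty)$ is called a localization pair if $N$ is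 continuous and strictly increasing with $\lim_{T\to+\infty}Te^{-\rho T}\log N(T)=0$, $\eta$ is continuous and strictly decreasing, $\eta(T)<N(T)$ for $T>0$, and for every $T\ge 1$ and every $u\in\Lambda$ with $\mathcal B(u)>V-1$ there is $w\in\Lambda$ with $\mathcal B(w)\ge\mathcal B(u)$ and $w=(u\wedge N(T))\vee\eta(T)$ a.e. in $[0,T]$. Given a localization pair $(N,\eta)$ and a maximizing sequence $(u_n)$ with $\mathcal B(u_n)>V-1$ for all $n$, consider the following procedures. First diagonal procedure: put $\bar u^0_n=u_n$ and, for $T=1,2,\dots$, choose $u^T_n\in\Lambda$ with $\mathcal B(u^T_n)\ge\mathcal B(\bar u^{T-1}_n)$ and $u^T_n=(\bar u^{T-1}_n\wedge N(T))\vee\eta(T)$ a.e. in $[0,T]$ (for all $n$), and a subsequence $\bar u^T_n=u^T_{\sigma_T(n)}$ ($\sigma_T$ strictly increasing) such that $(\bar u^T_n)_n$ converges weakly in $L^1([0,T])$; the choices are such that the weak limits on the intervals $[0,T]$ are the restrictions of one function $v$ on $[0,+\infty)$. Put $v_n=\bar u^n_n$. Second diagonal procedure: choose a subsequence $(v_{\tau(n)})_n$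 of $(v_n)_n$ and a function $f$ with $\log v_{\tau(n)}\rightharpoonup f$ weakly in $L^1([0,T])$ for every $T>0$. Put $u_*=e^{f}$. Then: (a) for every $u\in\Lambda$ the state $x(\cdot;x_0,u)$ exists and is unique on $[0,+\infty)$, and $V$ is finite; (b) localization pairs exist, and so do maximizing sequences $(u_n)$ with $\mathcal B(u_n)>V-1$ for all $n$; for every such pair and sequence the first procedure can be carried out, and after every outcome of it so can the second; (c) every control $u_*$ obtained in this way is optimal, and $u_*\in L^\infty_{loc}([0,+\infty))$. In particular, an optimal control exists and it can be chosen locally bounded. -/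

import Mathlib

open MeasureTheory Filter Topology Set

noncomputable section

namespace ShallowLake

/-- The standing hypotheses on the drift `F` of the generalized shallow-lake model. -/
structure IsLakeDrift (F : ℝ → ℝ) : Prop where
  contDiff : ContDiff ℝ 1 F
  deriv_nonpos : ∀ x, deriv F x ≤ 0
  map_zero : F 0 = 0
  tendsto_atBot : Tendsto F atTop atBot
  tendsto_deriv : ∃ l : ℝ, 0 < l ∧ Tendsto (deriv F) atTop (𝓝 (-l))
  convex_concave : ∃ xbar : ℝ, 0 < xbar ∧
    ConvexOn ℝ (Icc 0 xbar) F ∧ ConcaveOn ℝ (Ici xbar) F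
  deriv_zero_neg : deriv F 0 < 0

/-- `x` is a (Caratheodory) solution on `[0, ∞)` of `x' = F(x) + u`, `x(0) = x₀`,
in integrated form. Values of `x` and `u` at negative times are irrelevant. -/
def IsTrajectory (F : ℝ → ℝ) (x₀ : ℝ) (u x : ℝ → ℝ) : Prop :=
  ContinuousOn x (Ici 0) ∧ ∀ t, 0 ≤ t → x t = x₀ + ∫ s in (0 : ℝ)..t, (F (x s) + u s)

open Classical in
/-- The state `x(·; x₀, u)`: the solution of the Cauchy problem
(the value `0` is used only if there is no solution). -/
def state (F : ℝ → ℝ) (x₀ : ℝ) (u : ℝ → ℝ) : ℝ → ℝ :=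
  if h : ∃ x, IsTrajectory F x₀ u x then h.choose else 0

/-- Admissible controls: `u ∈ L¹_loc([0, ∞))` with `u > 0` almost everywhere in `[0, ∞)`. -/
def Admissible : Set (ℝ → ℝ) :=
  {u | LocallyIntegrableOn u (Ici 0) volume ∧ ∀ᵐ t ∂(volume.restrict (Ici (0 : ℝ))), 0 < u t}

/-- The running payoff `e^{-ρt} (log u(t) - c x(t; x₀, u)²)`. -/
def payoff (F : ℝ → ℝ) (ρ c x₀ : ℝ) (u : ℝ → ℝ) (t : ℝ) : ℝ :=
  Real.exp (-ρ * t) * (Real.log (u t) - c * state F x₀ u t ^ 2)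

/-- The objective functional `B(x₀; u)`, the extended-real integral of the payoff over `(0, ∞)`:
integral of the positive part minus integral of the negative part. -/
def objective (F : ℝ → ℝ) (ρ c x₀ : ℝ) (u : ℝ → ℝ) : EReal :=
  ((∫⁻ t in Ioi (0 : ℝ), ENNReal.ofReal (payoff F ρ c x₀ u t) : ENNReal) : EReal) -
    ((∫⁻ t in Ioi (0 : ℝ), ENNReal.ofReal (-payoff F ρ c x₀ u t) : ENNReal) : EReal)

/-- The value function `V(x₀)`. -/
def value (F : ℝ → ℝ) (ρ c x₀ : ℝ) : EReal :=
  ⨆ u ∈ Admissible, objective F ρ c x₀ u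

/-- A sequence of admissible controls that is maximizing at `x₀`. -/
def IsMaximizing (F : ℝ → ℝ) (ρ c x₀ : ℝ) (u : ℕ → ℝ → ℝ) : Prop :=
  (∀ n, u n ∈ Admissible) ∧
    Tendsto (fun n => objective F ρ c x₀ (u n)) atTop (𝓝 (value F ρ c x₀))

/-- An optimal control at `x₀`: an admissible control, with integrable payoff,
that attains the value. -/
def IsOptimal (F : ℝ → ℝ) (ρ c x₀ : ℝ) (u : ℝ → ℝ) : Prop :=
  u ∈ Admissible ∧ IntegrableOn (payoff F ρ c x₀ u) (Ioi 0) volume ∧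
    objective F ρ c x₀ u = value F ρ c x₀

/-- `L^∞_loc([0, ∞))`. -/
def LocallyEssBounded (u : ℝ → ℝ) : Prop :=
  ∀ T : ℝ, 0 < T → MemLp u ⊤ (volume.restrict (Icc 0 T))

/-- Weak convergence `f n ⇀ g` in `L¹([0, T])`, tested against `L^∞([0, T])`. -/
def WeakTendstoL1 (T : ℝ) (f : ℕ → ℝ → ℝ) (g : ℝ → ℝ) : Prop :=
  (∀ᶠ n in atTop, IntegrableOn (f n) (Icc 0 T) volume) ∧ IntegrableOn g (Icc 0 T) volume ∧
    ∀ φ : ℝ → ℝ, MemLp φ ⊤ (volume.restrict (Icc 0 T)) →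
      Tendsto (fun n => ∫ t in Icc 0 T, f n t * φ t) atTop (𝓝 (∫ t in Icc 0 T, g t * φ t))

/-- `N` and `η` are uniform localization bounds (from above and from below) at `x₀`:
every admissible control whose payoff is within `1` of the value can be replaced by one which is
at least as good and which on `[0, T]` is the truncation of the original between
`η T` and `N T`. -/
structure IsLocalizationPair (F : ℝ → ℝ) (ρ c x₀ : ℝ) (N η : ℝ → ℝ) : Prop where
  upper_pos : ∀ T, 0 ≤ T → 0 < N T
  upper_cont : ContinuousOn N (Ici 0)
  upper_mono : StrictMonoOn N (Ici 0)
  upper_growth : Tendsto (fun T => T * Real.exp (-ρ * T) * Real.log (N T)) atTop (𝓝 0)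
  lower_pos : ∀ T, 0 ≤ T → 0 < η T
  lower_cont : ContinuousOn η (Ici 0)
  lower_anti : StrictAntiOn η (Ici 0)
  lower_lt_upper : ∀ T, 0 < T → η T < N T
  localize : ∀ T, 1 ≤ T → ∀ u ∈ Admissible, value F ρ c x₀ - 1 < objective F ρ c x₀ u →
    ∃ w ∈ Admissible, objective F ρ c x₀ u ≤ objective F ρ c x₀ w ∧
      ∀ᵐ t ∂(volume.restrict (Icc 0 T)), w t = max (min (u t) (N T)) (η T)

/-- The two-families diagonal procedure. Starting from the maximizing sequence `u = ubar 0`,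
the step `T → T + 1` localizes every `ubar T n` on `[0, T + 1]`, which gives `w (T + 1) n`, and
then extracts from `w (T + 1)` a sequence `ubar (T + 1)` converging weakly in `L¹([0, T + 1])`.
The local weak limits are merged into the function `v`; the diagonal sequence of the procedure is
`n ↦ ubar n n`. The values `w 0` and `σ 0` are not used. -/
structure IsFirstDiagonal (F : ℝ → ℝ) (ρ c x₀ : ℝ) (N η : ℝ → ℝ) (u : ℕ → ℝ → ℝ)
    (w ubar : ℕ → ℕ → ℝ → ℝ) (σ : ℕ → ℕ → ℕ) (v : ℝ → ℝ) : Prop where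
  maximizing : IsMaximizing F ρ c x₀ u
  start : ∀ n, ubar 0 n = u n
  admissible : ∀ T n, w (T + 1) n ∈ Admissible
  better : ∀ T n, objective F ρ c x₀ (ubar T n) ≤ objective F ρ c x₀ (w (T + 1) n)
  truncated : ∀ (T n : ℕ), ∀ᵐ t ∂(volume.restrict (Icc (0 : ℝ) (T + 1))),
    w (T + 1) n t = max (min (ubar T n t) (N (T + 1))) (η (T + 1))
  strictMono : ∀ T, StrictMono (σ (T + 1))
  extracted : ∀ T n, ubar (T + 1) n = w (T + 1) (σ (T + 1) n)
  weak : ∀ T : ℕ, WeakTendstoL1 (T + 1) (ubar (T + 1)) v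

/-- The second (standard) diagonal procedure: a subsequence `n ↦ vseq (τ n)` whose logarithms
converge weakly to `f` in `L¹([0, T])` for every `T > 0`. -/
def IsSecondDiagonal (vseq : ℕ → ℝ → ℝ) (τ : ℕ → ℕ) (f : ℝ → ℝ) : Prop :=
  StrictMono τ ∧
    ∀ T : ℝ, 0 < T → WeakTendstoL1 T (fun n t => Real.log (vseq (τ n) t)) f

end ShallowLake

end

/-!
The running payoff has no sign and its logarithm is unbounded, so existence of an optimal control
rests on bounds that are uniform in the control, followed by weak compactness.

*States.* As `F` is nonincreasing, the difference of two trajectories solves a linear equation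
whose coefficient is `≤ 0`, and `≥ -K` on sets where `F` has Lipschitz constant `K`. Variation of
constants (`exists_weight`) then gives uniqueness, nonnegativity, monotone dependence on the
control (`state_mono`), and the estimate that the state decays at most exponentially
(`state_growth`). Existence follows from the Picard–Lindelöf theorem for a cut-off drift
(`exists_isTrajectoryOn`).

*Bounds for the payoff.* Along a trajectory, `u / (1 + x²) = (arctan x)' - F(x) / (1 + x²)`, and
`F(x) / (1 + x²)` is bounded for `x ≥ 0`. Hence the discounted integral of `u / (1 + x²)` over
`[T, ∞)` is at most `C e^{-ρT}` with `C` independent of `u` (`exists_integral_control_div_le`). Since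
`log u - c x² ≤ u / (1 + x²) + const`, the payoffs of all controls have integrable majorants with
uniformly small tails (`exists_payoff_le`). The value is therefore finite, and with `c / 2` in
place of `c` the same bound shows that near-optimal controls have bounded discounted quadratic cost
(`exists_integral_sq_le`), hence exponentially bounded mass on `[0, T]`
(`exists_integral_control_le`).

*Localization.* A near-optimal control may be cut off at a level `N` that is large compared with
its mass on `[0, T + 1]`: a fraction of the removed mass is returned as a constant on `(T, T + 1]`,
small enough for the state not to increase and large enough for the logarithmic gain to exceed the
loss (`exists_upper_truncation`). It may be raised to a small level `η`, since the logarithm gains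
at least `e^{-ρT} / η` per unit of mass while the additional cost per unit is bounded
(`exists_lower_truncation`). Both levels can be taken exponential in `T`
(`exists_isLocalizationPair`).

*The diagonal procedures.* A control localized on `[0, T]` is not changed there by the later
localizations, whose bounds are wider (`IsLocalizationPair.exists_ae_eq`). So on each bounded
interval the sequences stay between fixed positive bounds, and weak compactness in a weighted `L²`
space (`exists_subseq_weakTendstoL1`) provides the subsequences. For any outcome of the first
procedure the diagonal sequence is on `[0, T]` eventually a subsequence of the one of step `T`, so
it converges weakly to `v` on every bounded interval.

*Optimality.* Let `y ⇀ v` and `log y ⇀ f` along the final subsequence. Concavity of the logarithm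
gives `e^f ≤ v`, so the state of `e^f` is at most that of `v`, and the latter is the pointwise
limit of the states of `y` (`tendsto_state`). The payoff of `e^f` over `[0, T]` is thus at least
the limit of the payoffs of `y` over `[0, T]`, which is at least the value minus `C e^{-ρT}`.
Letting `T` tend to infinity gives optimality (`isOptimal_exp_of_weakTendstoL1`).
-/

namespace ShallowLake

/-! ### Linear equations and comparison of trajectories -/

lemma absolutelyContinuousOnInterval_comp {f G : ℝ → ℝ} {a b : ℝ} {K : NNReal} {s : Set ℝ}
    (hG : LipschitzOnWith K G s) (hf : AbsolutelyContinuousOnInterval f a b)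
    (hfs : MapsTo f (uIcc a b) s) :
    AbsolutelyContinuousOnInterval (fun t => G (f t)) a b := by
  rw [absolutelyContinuousOnInterval_iff] at hf ⊢
  intro ε hε
  obtain ⟨δ, hδ, h⟩ := hf (ε / (K + 1)) (by positivity)
  refine ⟨δ, hδ, fun E hE hE' => ?_⟩
  have h1 := h E hE hE'
  calc _ ≤ ∑ i ∈ Finset.range E.1, K * dist (f (E.2 i).1) (f (E.2 i).2) := by
        refine Finset.sum_le_sum fun i hi => ?_
        exact hG.dist_le_mul _ (hfs (hE.1 i hi).1) _ (hfs (hE.1 i hi).2)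
    _ = K * ∑ i ∈ Finset.range E.1, dist (f (E.2 i).1) (f (E.2 i).2) := by
        rw [Finset.mul_sum]
    _ ≤ K * (ε / (K + 1)) := by gcongr
    _ < ε := by
        rw [mul_div_assoc', div_lt_iff₀ (by positivity)]
        nlinarith

/-- Variation of constants for the scalar linear equation `d' = β d + h`, `d(0) = d₀`, with merely
integrable coefficients. -/
lemma exp_neg_integral_mul_eq {T d₀ : ℝ} {β h d : ℝ → ℝ} (hT : 0 ≤ T)
    (hβ : IntervalIntegrable β volume 0 T) (hh : IntervalIntegrable h volume 0 T)
    (hdc : ContinuousOn d (Icc 0 T))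
    (hd : ∀ t ∈ Icc 0 T, d t = d₀ + ∫ s in (0 : ℝ)..t, (β s * d s + h s)) :
    Real.exp (-∫ s in (0 : ℝ)..T, β s) * d T =
      d₀ + ∫ s in (0 : ℝ)..T, Real.exp (-∫ r in (0 : ℝ)..s, β r) * h s := by
  have hu : uIcc 0 T = Icc 0 T := uIcc_of_le hT
  have h0 : (0 : ℝ) ∈ uIcc 0 T := left_mem_uIcc
  have hg : IntervalIntegrable (fun s => β s * d s + h s) volume 0 T :=
    (hβ.mul_continuousOn (hu ▸ hdc)).add hh
  have hB : AbsolutelyContinuousOnInterval (fun t => -∫ s in (0 : ℝ)..t, β s) 0 T :=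
    (hβ.absolutelyContinuousOnInterval_intervalIntegral h0).neg
  have hE : AbsolutelyContinuousOnInterval
      (fun t => Real.exp (-∫ s in (0 : ℝ)..t, β s)) 0 T := by
    obtain ⟨C, hC⟩ := hB.exists_bound
    obtain ⟨K, hK⟩ := (Real.contDiff_exp (n := 1)).contDiffOn.exists_lipschitzOnWith
      (by decide) (convex_Icc (-C) C) isCompact_Icc
    exact absolutelyContinuousOnInterval_comp hK hB
      fun t ht => abs_le.1 (by simpa using hC t ht)
  have hP : AbsolutelyContinuousOnInterval
      (fun t => ∫ s in (0 : ℝ)..t, (β s * d s + h s)) 0 T :=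
    hg.absolutelyContinuousOnInterval_intervalIntegral h0
  -- with `E` the exponential, integration by parts for `E (d - d₀)`; adding `d₀` times the integral
  -- of `E'` turns the integrand `E' (d - d₀) + E d'` into `E' d + E d' = E h`
  have key := hE.integral_deriv_mul_eq_sub hP
  have hEc := hE.continuousOn
  have key2 := hE.integral_deriv_eq_sub
  have e1 : ∫ s in (0 : ℝ)..T, Real.exp (-∫ r in (0 : ℝ)..s, β r) * h s =
      (∫ x in (0 : ℝ)..T, (deriv (fun t => Real.exp (-∫ s in (0 : ℝ)..t, β s)) x *
        (∫ s in (0 : ℝ)..x, (β s * d s + h s)) + Real.exp (-∫ s in (0 : ℝ)..x, β s) *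
        deriv (fun t => ∫ s in (0 : ℝ)..t, (β s * d s + h s)) x)) +
      d₀ * ∫ x in (0 : ℝ)..T, deriv (fun t => Real.exp (-∫ s in (0 : ℝ)..t, β s)) x := by
    rw [← intervalIntegral.integral_const_mul, ← intervalIntegral.integral_add]
    · apply intervalIntegral.integral_congr_ae
      filter_upwards [hβ.ae_hasDerivAt_integral, hg.ae_hasDerivAt_integral] with t h1 h2 ht
      have ht' : t ∈ uIcc 0 T := uIoc_subset_uIcc ht
      have h3 := ((h1 ht' 0 h0).neg.exp).deriv
      have h4 := (h2 ht' 0 h0).deriv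
      simp only [Pi.neg_apply] at h3
      have h5 := hd t (hu ▸ ht')
      have h6 : deriv (fun t => Real.exp (-∫ s in (0 : ℝ)..t, β s)) t =
        Real.exp (-∫ s in (0 : ℝ)..t, β s) * -β t := h3
      rw [h6, h4]
      have h7 : ∫ s in (0 : ℝ)..t, (β s * d s + h s) = d t - d₀ := by linarith
      rw [h7]; ring
    · exact (hE.intervalIntegrable_deriv.mul_continuousOn hP.continuousOn).add
        (hP.intervalIntegrable_deriv.continuousOn_mul hE.continuousOn)
    · exact hE.intervalIntegrable_deriv.const_mul _
  rw [e1, key, key2, hd T ⟨hT, le_rfl⟩]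
  simp
  ring

/-- A solution of `x' = F(x) + u`, `x(0) = x₀` on the bounded interval `[0, T]`. -/
def IsTrajectoryOn (F : ℝ → ℝ) (x₀ : ℝ) (u : ℝ → ℝ) (T : ℝ) (x : ℝ → ℝ) : Prop :=
  ContinuousOn x (Icc 0 T) ∧
    ∀ t ∈ Icc 0 T, x t = x₀ + ∫ s in (0 : ℝ)..t, (F (x s) + u s)

lemma IsTrajectory.on {F : ℝ → ℝ} {x₀ : ℝ} {u x : ℝ → ℝ} (h : IsTrajectory F x₀ u x) (T : ℝ) :
    IsTrajectoryOn F x₀ u T x :=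
  ⟨h.1.mono Icc_subset_Ici_self, fun t ht => h.2 t ht.1⟩

lemma IsTrajectoryOn.mono {F : ℝ → ℝ} {x₀ T S : ℝ} {u x : ℝ → ℝ}
    (h : IsTrajectoryOn F x₀ u T x) (hST : S ≤ T) : IsTrajectoryOn F x₀ u S x :=
  ⟨h.1.mono (Icc_subset_Icc_right hST), fun t ht => h.2 t ⟨ht.1, ht.2.trans hST⟩⟩

/-- The difference of two trajectories solves a linear equation with coefficient in `[-K, 0]`,
where `K` is a Lipschitz constant of the drift; `E` is the reciprocal of its resolvent. -/
lemma exists_weight {F : ℝ → ℝ} {K T x₀ y₀ : ℝ} {S : Set ℝ} {u w x y : ℝ → ℝ}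
    (hF : Continuous F) (hanti : Antitone F) (hK : 0 ≤ K)
    (hLip : ∀ a ∈ S, ∀ b ∈ S, |F a - F b| ≤ K * |a - b|)
    (hu : IntervalIntegrable u volume 0 T) (hw : IntervalIntegrable w volume 0 T)
    (hx : IsTrajectoryOn F x₀ u T x) (hy : IsTrajectoryOn F y₀ w T y)
    (hxS : MapsTo x (Icc 0 T) S) (hyS : MapsTo y (Icc 0 T) S) :
    ∃ E : ℝ → ℝ, ContinuousOn E (Icc 0 T) ∧ E 0 = 1 ∧
      (∀ r t, 0 ≤ r → r ≤ t → t ≤ T → E r ≤ E t ∧ E t ≤ Real.exp (K * (t - r)) * E r) ∧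
      ∀ t ∈ Icc 0 T, E t * (x t - y t) = (x₀ - y₀) + ∫ s in (0 : ℝ)..t, E s * (u s - w s) := by
  set β : ℝ → ℝ := fun s => (F (x s) - F (y s)) / (x s - y s) with hβdef
  have hβ_mul : ∀ s, β s * (x s - y s) = F (x s) - F (y s) := by
    intro s
    by_cases h : x s - y s = 0
    · rw [sub_eq_zero.1 h]; simp
    · exact div_mul_cancel₀ _ h
  have hβ0 : ∀ s, β s ≤ 0 := by
    intro s
    rcases le_total (x s) (y s) with h | h
    · exact div_nonpos_of_nonneg_of_nonpos (sub_nonneg.2 (hanti h)) (sub_nonpos.2 h)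
    · exact div_nonpos_of_nonpos_of_nonneg (sub_nonpos.2 (hanti h)) (sub_nonneg.2 h)
  have hβK : ∀ s ∈ Icc 0 T, -K ≤ β s := by
    intro s hs
    have h1 := hLip _ (hxS hs) _ (hyS hs)
    have h2 : |β s| ≤ K := by
      rw [hβdef, abs_div]
      exact div_le_of_le_mul₀ (abs_nonneg _) hK h1
    exact (abs_le.1 h2).1
  have hβi : ∀ r t, 0 ≤ r → r ≤ t → t ≤ T → IntervalIntegrable β volume r t := by
    intro r t hr hrt htT
    have hsub : Icc r t ⊆ Icc 0 T := Icc_subset_Icc hr htT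
    rw [intervalIntegrable_iff_integrableOn_Icc_of_le hrt]
    refine Integrable.of_bound (C := K) ?_ ?_
    · exact (((hF.comp_continuousOn hx.1).sub (hF.comp_continuousOn hy.1)).mono hsub
        |>.aestronglyMeasurable measurableSet_Icc).aemeasurable.div
        ((hx.1.sub hy.1).mono hsub |>.aestronglyMeasurable measurableSet_Icc).aemeasurable
        |>.aestronglyMeasurable
    · filter_upwards [ae_restrict_mem measurableSet_Icc] with s hs
      rw [Real.norm_eq_abs, abs_le]
      exact ⟨hβK s (hsub hs), (hβ0 s).trans hK⟩
  refine ⟨fun t => Real.exp (-∫ s in (0 : ℝ)..t, β s), ?_, by simp, ?_, ?_⟩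
  · rcases lt_or_ge T 0 with hT | hT
    · simp [Icc_eq_empty (not_le.2 hT)]
    · have := (intervalIntegral.continuousOn_primitive_interval'
        (hβi 0 T le_rfl hT le_rfl) left_mem_uIcc)
      rw [uIcc_of_le hT] at this
      exact (this.neg).rexp
  · intro r t hr hrt htT
    have h1 := intervalIntegral.integral_add_adjacent_intervals (hβi 0 r le_rfl hr (hrt.trans htT))
      (hβi r t hr hrt htT)
    have h2 : ∫ s in r..t, β s ≤ 0 := by
      have := intervalIntegral.integral_mono_on hrt (hβi r t hr hrt htT)
        (intervalIntegrable_const (c := (0 : ℝ))) fun s _ => hβ0 s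
      simpa using this
    have h3 : -K * (t - r) ≤ ∫ s in r..t, β s := by
      have := intervalIntegral.integral_mono_on hrt (intervalIntegrable_const (c := -K))
        (hβi r t hr hrt htT) fun s hs => hβK s ⟨hr.trans hs.1, hs.2.trans htT⟩
      simp only [intervalIntegral.integral_const, smul_eq_mul] at this
      linarith
    refine ⟨Real.exp_le_exp.2 (by linarith), ?_⟩
    rw [← Real.exp_add]
    exact Real.exp_le_exp.2 (by linarith)
  · intro t ht
    have hsub : Icc 0 t ⊆ Icc 0 T := Icc_subset_Icc_right ht.2
    have hi : ∀ s, s ∈ Icc 0 t → uIcc 0 s ⊆ uIcc 0 T := fun s hs => by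
      rw [uIcc_of_le hs.1, uIcc_of_le (ht.1.trans ht.2)]
      exact Icc_subset_Icc_right (hs.2.trans ht.2)
    have ht0 : t ∈ Icc 0 t := ⟨ht.1, le_rfl⟩
    refine exp_neg_integral_mul_eq (d := fun s => x s - y s) ht.1 (hβi 0 t le_rfl ht.1 ht.2)
      ((hu.sub hw).mono_set (hi t ht0)) ((hx.1.sub hy.1).mono hsub) fun s hs => ?_
    have hFi : ∀ z : ℝ → ℝ, ContinuousOn z (Icc 0 T) →
        IntervalIntegrable (fun r => F (z r)) volume 0 s := fun z hz =>
      ContinuousOn.intervalIntegrable ((hF.comp_continuousOn hz).mono (by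
        rw [uIcc_of_le hs.1]; exact Icc_subset_Icc_right (hs.2.trans ht.2)))
    rw [hx.2 s (hsub hs), hy.2 s (hsub hs), add_sub_add_comm, ← intervalIntegral.integral_sub
      ((hFi x hx.1).add (hu.mono_set (hi s hs))) ((hFi y hy.1).add (hw.mono_set (hi s hs)))]
    congr 1
    refine intervalIntegral.integral_congr fun r _ => ?_
    simp only [hβ_mul]
    ring

/-! ### The drift -/

lemma IsLakeDrift.continuous {F : ℝ → ℝ} (hF : IsLakeDrift F) : Continuous F :=
  hF.contDiff.continuous

lemma IsLakeDrift.antitone {F : ℝ → ℝ} (hF : IsLakeDrift F) : Antitone F :=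
  antitone_of_deriv_nonpos (hF.contDiff.differentiable (by decide)) hF.deriv_nonpos

lemma IsLakeDrift.nonpos {F : ℝ → ℝ} (hF : IsLakeDrift F) {x : ℝ} (hx : 0 ≤ x) : F x ≤ 0 :=
  hF.map_zero ▸ hF.antitone hx

lemma IsLakeDrift.exists_lipschitz_Icc {F : ℝ → ℝ} (hF : IsLakeDrift F) (M : ℝ) : ∃ K : NNReal,
    LipschitzOnWith K F (Icc (-M) M) :=
  hF.contDiff.contDiffOn.exists_lipschitzOnWith (by decide) (convex_Icc _ _) isCompact_Icc

lemma IsLakeDrift.exists_lipschitz {F : ℝ → ℝ} (hF : IsLakeDrift F) : ∃ K : ℝ, 0 < K ∧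
    ∀ a ∈ Ici (0 : ℝ), ∀ b ∈ Ici (0 : ℝ), |F a - F b| ≤ K * |a - b| := by
  obtain ⟨l, hl, hlim⟩ := hF.tendsto_deriv
  obtain ⟨R, hR⟩ := eventually_atTop.1 (hlim.eventually (Ioo_mem_nhds (by linarith : -l - 1 < -l)
    (by linarith : -l < -l + 1)))
  obtain ⟨C, hC⟩ := (isCompact_Icc (a := (0 : ℝ)) (b := R)).exists_bound_of_continuousOn
    (hF.contDiff.continuous_deriv (by decide)).continuousOn
  refine ⟨max C (l + 1), lt_max_of_lt_right (by linarith), fun a ha b hb => ?_⟩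
  refine Convex.norm_image_sub_le_of_norm_deriv_le (s := Ici (0 : ℝ)) (f := F)
    (fun x _ => hF.contDiff.differentiable (by decide) x) (fun x hx => ?_) (convex_Ici 0) hb ha
  rcases le_total x R with h | h
  · exact (hC x ⟨hx, h⟩).trans (le_max_left _ _)
  · have := hR x h
    refine le_trans ?_ (le_max_right _ _)
    rw [Real.norm_eq_abs, abs_le]
    constructor <;> linarith [this.1, this.2]

/-! ### Existence and uniqueness of the state -/

lemma IsTrajectoryOn.eqOn {F : ℝ → ℝ} (hF : IsLakeDrift F)
    {x₀ T : ℝ} {u x y : ℝ → ℝ} (hu : IntervalIntegrable u volume 0 T)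
    (hx : IsTrajectoryOn F x₀ u T x) (hy : IsTrajectoryOn F x₀ u T y) : EqOn x y (Icc 0 T) := by
  obtain ⟨A, hA⟩ := isCompact_Icc.exists_bound_of_continuousOn hx.1
  obtain ⟨B, hB⟩ := isCompact_Icc.exists_bound_of_continuousOn hy.1
  obtain ⟨K, hK⟩ := hF.exists_lipschitz_Icc (max A B)
  obtain ⟨E, -, hE0, hE, hxy⟩ := exists_weight (S := Icc (-max A B) (max A B)) hF.continuous
    hF.antitone K.2 (fun a ha b hb => hK.dist_le_mul a ha b hb) hu hu hx hy
    (fun t ht => abs_le.1 ((hA t ht).trans (le_max_left _ _)))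
    (fun t ht => abs_le.1 ((hB t ht).trans (le_max_right _ _)))
  intro t ht
  have h1 := hxy t ht
  have h2 := (hE 0 t le_rfl ht.1 ht.2).1
  simp only [sub_self, mul_zero, intervalIntegral.integral_zero, add_zero, mul_eq_zero] at h1
  rcases h1 with h1 | h1 <;> linarith

lemma IsTrajectoryOn.nonneg {F : ℝ → ℝ} (hF : IsLakeDrift F)
    {x₀ T : ℝ} {u x : ℝ → ℝ} (hx₀ : 0 ≤ x₀)
    (hu : IntervalIntegrable u volume 0 T) (hu0 : ∀ᵐ t ∂(volume.restrict (Icc 0 T)), 0 ≤ u t)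
    (hx : IsTrajectoryOn F x₀ u T x) : ∀ t ∈ Icc 0 T, 0 ≤ x t := by
  obtain ⟨A, hA⟩ := isCompact_Icc.exists_bound_of_continuousOn hx.1
  obtain ⟨K, hK⟩ := hF.exists_lipschitz_Icc A
  have hy : IsTrajectoryOn F 0 0 T 0 := ⟨continuousOn_const, fun t _ => by simp [hF.map_zero]⟩
  intro t ht
  have hA0 : 0 ≤ A := (norm_nonneg _).trans (hA t ht)
  obtain ⟨E, -, hE0, hE, hxy⟩ := exists_weight (S := Icc (-A) A) hF.continuous
    hF.antitone K.2 (fun a ha b hb => hK.dist_le_mul a ha b hb) hu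
    (intervalIntegrable_const (c := (0 : ℝ))) hx hy
    (fun t ht => abs_le.1 (hA t ht)) (fun t ht => by simp [hA0])
  have h1 := hxy t ht
  have h2 := (hE 0 t le_rfl ht.1 ht.2).1
  have h3 : 0 ≤ ∫ s in (0 : ℝ)..t, E s * (u s - (fun _ => (0 : ℝ)) s) := by
    apply intervalIntegral.integral_nonneg_of_ae_restrict ht.1
    have hsub : Icc 0 t ⊆ Icc 0 T := Icc_subset_Icc_right ht.2
    filter_upwards [ae_restrict_of_ae_restrict_of_subset hsub hu0,
      ae_restrict_mem measurableSet_Icc] with s hs hs'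
    have := (hE 0 s le_rfl hs'.1 (hs'.2.trans ht.2)).1
    simp only [sub_zero, Pi.zero_apply]
    exact mul_nonneg (by linarith) hs
  simp only [sub_zero, Pi.zero_apply] at h1 h3
  have h4 : 0 ≤ E t * x t := by rw [h1]; linarith
  exact nonneg_of_mul_nonneg_right h4 (by linarith)

/-- Existence on bounded intervals. With `U` the primitive of the control, the difference
`y = x - U` solves `y' = F(y + U)`, an equation with continuous right-hand side. -/
lemma exists_isTrajectoryOn {F : ℝ → ℝ} (hF : IsLakeDrift F)
    {x₀ T : ℝ} {u : ℝ → ℝ} (hx₀ : 0 ≤ x₀) (hT : 0 ≤ T)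
    (hu : IntervalIntegrable u volume 0 T) (hu0 : ∀ᵐ t ∂(volume.restrict (Icc 0 T)), 0 ≤ u t) :
    ∃ x, IsTrajectoryOn F x₀ u T x := by
  set U : ℝ → ℝ := fun t => x₀ + ∫ s in (0 : ℝ)..t, u s with hU
  have hUc : ContinuousOn U (Icc 0 T) := by
    have := intervalIntegral.continuousOn_primitive_interval' hu left_mem_uIcc
    rw [uIcc_of_le hT] at this
    exact continuousOn_const.add this
  have hui : ∀ r t, 0 ≤ r → r ≤ t → t ≤ T → IntervalIntegrable u volume r t := fun r t h1 h2 h3 =>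
    hu.mono_set (by
      rw [uIcc_of_le h2, uIcc_of_le hT]; exact Icc_subset_Icc h1 h3)
  have hUmono : ∀ r t, 0 ≤ r → r ≤ t → t ≤ T → U r ≤ U t := by
    intro r t h1 h2 h3
    have := intervalIntegral.integral_add_adjacent_intervals (hui 0 r le_rfl h1 (h2.trans h3))
      (hui r t h1 h2 h3)
    have h4 : 0 ≤ ∫ s in r..t, u s := by
      apply intervalIntegral.integral_nonneg_of_ae_restrict h2
      exact ae_restrict_of_ae_restrict_of_subset (Icc_subset_Icc h1 h3) hu0
    simp only [hU]; linarith
  have hU0 : U 0 = x₀ := by simp [hU]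
  set M := U T
  have hM : 0 ≤ M := hx₀.trans (hU0 ▸ hUmono 0 T le_rfl hT le_rfl)
  -- the drift is cut off outside `[0, M]`, an interval which the solution turns out not to leave
  set G : ℝ → ℝ := fun x => F (max 0 (min x M)) with hG
  have hGm : ∀ x, max 0 (min x M) ∈ Icc 0 M := fun x => ⟨le_max_left _ _, by simp [hM]⟩
  obtain ⟨K, hK⟩ := hF.exists_lipschitz_Icc M
  have hGL : ∀ x y, dist (G x) (G y) ≤ K * dist x y := by
    intro x y
    refine (hK.dist_le_mul _ ⟨by linarith [(hGm x).1], (hGm x).2⟩ _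
      ⟨by linarith [(hGm y).1], (hGm y).2⟩).trans ?_
    gcongr
    simp only [Real.dist_eq]
    refine (abs_max_sub_max_le_max _ _ _ _).trans ?_
    simp only [sub_self, abs_zero]
    refine max_le (abs_nonneg _) ((abs_min_sub_min_le_max _ _ _ _).trans ?_)
    simp
  have hG0 : ∀ x, G x ≤ 0 := fun x => hF.nonpos (le_max_left _ _)
  have hGM : ∀ x, F M ≤ G x := fun x => hF.antitone (hGm x).2
  have hGc : Continuous G := hF.continuous.comp (by fun_prop)
  have hFM : 0 ≤ -F M := by linarith [hF.nonpos hM]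
  have h0T : (0 : ℝ) ∈ Icc 0 T := ⟨le_rfl, hT⟩
  obtain ⟨L, hL⟩ : ∃ L : NNReal, (L : ℝ) = -F M := ⟨⟨-F M, hFM⟩, rfl⟩
  have hPL : IsPicardLindelof (fun t y => G (y + U t)) (tmin := 0) (tmax := T)
      ⟨0, h0T⟩ (0 : ℝ) (L * T.toNNReal) 0 L K := by
    refine ⟨fun t _ => LipschitzOnWith.of_dist_le_mul fun y _ z _ => ?_, fun y _ => ?_,
      fun t _ y _ => ?_, ?_⟩
    · refine (hGL _ _).trans ?_
      simp
    · exact hGc.comp_continuousOn (continuousOn_const.add hUc)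
    · rw [Real.norm_eq_abs, abs_of_nonpos (hG0 _), hL]
      exact neg_le_neg (hGM _)
    · simp [hT]
  obtain ⟨α, hα⟩ := ODE.FunSpace.exists_isFixedPt_next hPL (x := 0) (by simp)
  set y := (ODE.FunSpace.next hPL (x := 0) (by simp) α).compProj with hy
  have hyc : Continuous y := ODE.FunSpace.continuous_compProj _
  have hyeq : ∀ t ∈ Icc 0 T, y t = ∫ s in (0 : ℝ)..t, G (y s + U s) := by
    intro t ht
    rw [hy, ODE.FunSpace.compProj_apply, ODE.FunSpace.next_apply, hα, projIcc_of_mem _ ht]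
    simp [ODE.picard_apply]
  have hgi : ∀ r t, 0 ≤ r → r ≤ t → t ≤ T →
      IntervalIntegrable (fun s => G (y s + U s)) volume r t := fun r t h1 h2 h3 =>
    ContinuousOn.intervalIntegrable (by
      rw [uIcc_of_le h2]
      exact (hGc.comp_continuousOn (hyc.continuousOn.add hUc)).mono (Icc_subset_Icc h1 h3))
  have hup : ∀ t ∈ Icc 0 T, y t + U t ≤ M := by
    intro t ht
    have h1 : y t ≤ 0 := by
      rw [hyeq t ht]
      have := intervalIntegral.integral_mono_on ht.1 (hgi 0 t le_rfl ht.1 ht.2)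
        (intervalIntegrable_const (c := (0 : ℝ))) fun s _ => hG0 _
      simpa using this
    linarith [hUmono t T ht.1 ht.2 le_rfl]
  -- below zero the truncated drift vanishes, so the solution cannot become negative
  have hlow : ∀ t ∈ Icc 0 T, 0 ≤ y t + U t := by
    intro t ht
    by_contra! hneg
    set Z := {s ∈ Icc 0 t | 0 ≤ y s + U s} with hZ
    have hxc : ContinuousOn (fun s => y s + U s) (Icc 0 t) :=
      hyc.continuousOn.add (hUc.mono (Icc_subset_Icc_right ht.2))
    have hZc : IsClosed Z := by
      have := hxc.preimage_isClosed_of_isClosed isClosed_Icc (isClosed_Ici (a := (0 : ℝ)))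
      exact this
    have h0Z : (0 : ℝ) ∈ Z := by
      refine ⟨⟨le_rfl, ht.1⟩, ?_⟩
      rw [hyeq 0 ⟨le_rfl, hT⟩, hU0]; simpa using hx₀
    have hbdd : BddAbove Z := ⟨t, fun s hs => hs.1.2⟩
    set r := sSup Z
    have hr : r ∈ Z := hZc.csSup_mem ⟨0, h0Z⟩ hbdd
    have hrt := hr.1.2
    have h1 := intervalIntegral.integral_add_adjacent_intervals
      (hgi 0 r le_rfl hr.1.1 (hrt.trans ht.2)) (hgi r t hr.1.1 hrt ht.2)
    rw [← hyeq r ⟨hr.1.1, hrt.trans ht.2⟩, ← hyeq t ht] at h1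
    have h2 : ∫ s in r..t, G (y s + U s) = 0 := by
      rw [intervalIntegral.integral_of_le hrt]
      rw [setIntegral_congr_fun measurableSet_Ioc (g := fun _ => (0 : ℝ))]
      · simp
      · intro s hs
        have h3 : y s + U s < 0 := by
          by_contra! h
          exact absurd (le_csSup hbdd (show s ∈ Z from ⟨⟨hr.1.1.trans hs.1.le, hs.2⟩, h⟩))
            (not_le.2 hs.1)
        simp only [hG]
        rw [min_eq_left (by linarith), max_eq_left h3.le, hF.map_zero]
    linarith [hr.2, hUmono r t hr.1.1 hrt ht.2]
  refine ⟨fun t => y t + U t, hyc.continuousOn.add hUc, fun t ht => ?_⟩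
  have h1 : ∫ s in (0 : ℝ)..t, G (y s + U s) = ∫ s in (0 : ℝ)..t, F (y s + U s) := by
    refine intervalIntegral.integral_congr fun s hs => ?_
    rw [uIcc_of_le ht.1] at hs
    have hs' : s ∈ Icc 0 T := ⟨hs.1, hs.2.trans ht.2⟩
    simp only [hG]
    rw [min_eq_left (hup s hs'), max_eq_right (hlow s hs')]
  have h2 : IntervalIntegrable (fun s => F (y s + U s)) volume 0 t :=
    ContinuousOn.intervalIntegrable (by
      rw [uIcc_of_le ht.1]
      exact (hF.continuous.comp_continuousOn (hyc.continuousOn.add hUc)).mono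
        (Icc_subset_Icc_right ht.2))
  rw [intervalIntegral.integral_add h2 (hui 0 t le_rfl ht.1 ht.2), ← h1, ← hyeq t ht]
  simp only [hU]; ring

/-! ### Admissible controls and their states -/

lemma admissible_intervalIntegrable {u : ℝ → ℝ} (hu : u ∈ Admissible) {a b : ℝ} (ha : 0 ≤ a)
    (hb : 0 ≤ b) : IntervalIntegrable u volume a b := by
  rw [intervalIntegrable_iff]
  exact (hu.1.integrableOn_compact_subset (t := uIcc a b)
    (fun t ht => (le_inf ha hb).trans ht.1) isCompact_uIcc).mono_set uIoc_subset_uIcc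

lemma admissible_integrableOn_Icc {u : ℝ → ℝ} (hu : u ∈ Admissible) (T : ℝ) :
    IntegrableOn u (Icc 0 T) :=
  hu.1.integrableOn_compact_subset Icc_subset_Ici_self isCompact_Icc

lemma admissible_ae_pos {u : ℝ → ℝ} (hu : u ∈ Admissible) {s : Set ℝ} (hs : s ⊆ Ici 0) :
    ∀ᵐ t ∂(volume.restrict s), 0 < u t :=
  ae_restrict_of_ae_restrict_of_subset hs hu.2

lemma locallyIntegrableOn_Ici_of_nat {u : ℝ → ℝ} (h : ∀ n : ℕ, IntegrableOn u (Icc 0 (n : ℝ))) :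
    LocallyIntegrableOn u (Ici 0) := by
  rw [locallyIntegrableOn_iff isClosed_Ici.isLocallyClosed]
  intro k hk hkc
  obtain ⟨M, hM⟩ := hkc.bddAbove
  obtain ⟨n, hn⟩ := exists_nat_ge M
  exact (h n).mono_set fun t ht => ⟨hk ht, (hM ht).trans hn⟩

lemma admissible_iff {u : ℝ → ℝ} : u ∈ Admissible ↔
    (∀ n : ℕ, IntegrableOn u (Icc 0 (n : ℝ))) ∧ ∀ᵐ t ∂(volume.restrict (Ici (0 : ℝ))), 0 < u t :=
  ⟨fun h => ⟨fun _ => admissible_integrableOn_Icc h _, h.2⟩,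
    fun h => ⟨locallyIntegrableOn_Ici_of_nat h.1, h.2⟩⟩

lemma exists_isTrajectory {F : ℝ → ℝ} (hF : IsLakeDrift F) {x₀ : ℝ} (hx₀ : 0 ≤ x₀) {u : ℝ → ℝ}
    (hu : u ∈ Admissible) : ∃ x, IsTrajectory F x₀ u x := by
  have hui : ∀ T, 0 ≤ T → IntervalIntegrable u volume 0 T := fun T hT =>
    admissible_intervalIntegrable hu le_rfl hT
  have hex : ∀ T : ℝ, ∃ x, 0 ≤ T → IsTrajectoryOn F x₀ u T x := by
    intro T
    by_cases hT : 0 ≤ T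
    · obtain ⟨x, hx⟩ := exists_isTrajectoryOn hF hx₀ hT (hui T hT)
        ((admissible_ae_pos hu Icc_subset_Ici_self).mono fun _ h => h.le)
      exact ⟨x, fun _ => hx⟩
    · exact ⟨0, fun h => absurd h hT⟩
  choose sol hsol using hex
  -- the solutions on the intervals `[0, T]` agree where they are defined
  have heq : ∀ T, 0 ≤ T → ∀ t ∈ Icc 0 T, sol t t = sol T t := fun T hT t ht =>
    IsTrajectoryOn.eqOn hF (hui t ht.1) (hsol t ht.1) ((hsol T hT).mono ht.2) ⟨ht.1, le_rfl⟩
  refine ⟨fun t => sol t t, fun t ht => ?_, fun t ht => ?_⟩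
  · have hT : 0 ≤ t + 1 := add_nonneg ht zero_le_one
    have h1 : ContinuousOn (fun t => sol t t) (Icc 0 (t + 1)) :=
      (hsol _ hT).1.congr fun s hs => heq _ hT s hs
    refine (h1 t ⟨ht, by linarith⟩).mono_of_mem_nhdsWithin ?_
    exact mem_nhdsWithin.2 ⟨Iio (t + 1), isOpen_Iio, by simp, fun s hs => ⟨hs.2, hs.1.le⟩⟩
  · have h1 := (hsol t ht).2 t ⟨ht, le_rfl⟩
    refine h1.trans ?_
    congr 1
    refine intervalIntegral.integral_congr fun s hs => ?_
    rw [uIcc_of_le ht] at hs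
    simp only [heq t ht s hs]

lemma isTrajectory_state {F : ℝ → ℝ} (hF : IsLakeDrift F) {x₀ : ℝ} (hx₀ : 0 ≤ x₀) {u : ℝ → ℝ}
    (hu : u ∈ Admissible) : IsTrajectory F x₀ u (state F x₀ u) := by
  have h := exists_isTrajectory hF hx₀ hu
  rw [state, dif_pos h]
  exact h.choose_spec

lemma IsTrajectory.eqOn {F : ℝ → ℝ} (hF : IsLakeDrift F) {x₀ : ℝ} {u x y : ℝ → ℝ}
    (hu : u ∈ Admissible) (hx : IsTrajectory F x₀ u x) (hy : IsTrajectory F x₀ u y) :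
    EqOn x y (Ici 0) := fun t ht =>
  IsTrajectoryOn.eqOn hF (admissible_intervalIntegrable hu le_rfl ht) (hx.on t) (hy.on t) ⟨ht, le_rfl⟩

lemma state_nonneg {F : ℝ → ℝ} (hF : IsLakeDrift F) {x₀ : ℝ} (hx₀ : 0 ≤ x₀) {u : ℝ → ℝ}
    (hu : u ∈ Admissible) {t : ℝ} (ht : 0 ≤ t) : 0 ≤ state F x₀ u t :=
  IsTrajectoryOn.nonneg hF hx₀ (admissible_intervalIntegrable hu le_rfl ht)
    ((admissible_ae_pos hu Icc_subset_Ici_self).mono fun _ h => h.le)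
    ((isTrajectory_state hF hx₀ hu).on t) t ⟨ht, le_rfl⟩

lemma continuousOn_state {F : ℝ → ℝ} (hF : IsLakeDrift F) {x₀ : ℝ} (hx₀ : 0 ≤ x₀) {u : ℝ → ℝ}
    (hu : u ∈ Admissible) : ContinuousOn (state F x₀ u) (Ici 0) :=
  (isTrajectory_state hF hx₀ hu).1

lemma intervalIntegrable_comp_state {F : ℝ → ℝ} (hF : IsLakeDrift F) {x₀ : ℝ} (hx₀ : 0 ≤ x₀)
    {u : ℝ → ℝ} (hu : u ∈ Admissible) {G : ℝ → ℝ} (hG : Continuous G) {a b : ℝ} (ha : 0 ≤ a)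
    (hb : 0 ≤ b) : IntervalIntegrable (fun t => G (state F x₀ u t)) volume a b :=
  ContinuousOn.intervalIntegrable ((hG.comp_continuousOn (continuousOn_state hF hx₀ hu)).mono
    fun _ ht => (le_inf ha hb).trans ht.1)

lemma state_le {F : ℝ → ℝ} (hF : IsLakeDrift F) {x₀ : ℝ} (hx₀ : 0 ≤ x₀) {u : ℝ → ℝ}
    (hu : u ∈ Admissible) {t : ℝ} (ht : 0 ≤ t) :
    state F x₀ u t ≤ x₀ + ∫ s in (0 : ℝ)..t, u s := by
  rw [(isTrajectory_state hF hx₀ hu).2 t ht]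
  gcongr
  refine intervalIntegral.integral_mono_on ht ((intervalIntegrable_comp_state hF hx₀ hu
    hF.continuous le_rfl ht).add (admissible_intervalIntegrable hu le_rfl ht))
    (admissible_intervalIntegrable hu le_rfl ht) fun s hs => ?_
  linarith [hF.nonpos (state_nonneg hF hx₀ hu hs.1)]

/-- Comparison of the states of two admissible controls. -/
lemma exists_weight_state {F : ℝ → ℝ} (hF : IsLakeDrift F) {K : ℝ} (hK : 0 < K)
    (hLip : ∀ a ∈ Ici (0 : ℝ), ∀ b ∈ Ici (0 : ℝ), |F a - F b| ≤ K * |a - b|)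
    {x₀ : ℝ} (hx₀ : 0 ≤ x₀) {u w : ℝ → ℝ} (hu : u ∈ Admissible) (hw : w ∈ Admissible)
    {T : ℝ} (hT : 0 ≤ T) :
    ∃ E : ℝ → ℝ, ContinuousOn E (Icc 0 T) ∧ E 0 = 1 ∧
      (∀ r t, 0 ≤ r → r ≤ t → t ≤ T → E r ≤ E t ∧ E t ≤ Real.exp (K * (t - r)) * E r) ∧
      ∀ t ∈ Icc 0 T, E t * (state F x₀ u t - state F x₀ w t) =
        ∫ s in (0 : ℝ)..t, E s * (u s - w s) := by
  simpa using exists_weight (S := Ici 0) hF.continuous hF.antitone hK.le hLip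
    (admissible_intervalIntegrable hu le_rfl hT) (admissible_intervalIntegrable hw le_rfl hT)
    ((isTrajectory_state hF hx₀ hu).on T) ((isTrajectory_state hF hx₀ hw).on T)
    (fun t ht => state_nonneg hF hx₀ hu ht.1) (fun t ht => state_nonneg hF hx₀ hw ht.1)

lemma state_mono {F : ℝ → ℝ} (hF : IsLakeDrift F) {x₀ : ℝ} (hx₀ : 0 ≤ x₀) {u w : ℝ → ℝ}
    (hu : u ∈ Admissible) (hw : w ∈ Admissible) {t : ℝ} (ht : 0 ≤ t)
    (huw : ∀ᵐ s ∂(volume.restrict (Icc 0 t)), w s ≤ u s) :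
    state F x₀ w t ≤ state F x₀ u t ∧
      state F x₀ u t - state F x₀ w t ≤ ∫ s in (0 : ℝ)..t, (u s - w s) := by
  obtain ⟨K, hK, hLip⟩ := hF.exists_lipschitz
  obtain ⟨E, hEc, hE0, hE, heq⟩ := exists_weight_state hF hK hLip hx₀ hu hw ht
  have h1 := heq t ⟨ht, le_rfl⟩
  have hEt := (hE 0 t le_rfl ht le_rfl).1
  have hsub := (admissible_intervalIntegrable hu le_rfl ht).sub
    (admissible_intervalIntegrable hw le_rfl ht)
  have hi : IntervalIntegrable (fun s => E s * (u s - w s)) volume 0 t :=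
    hsub.continuousOn_mul (by rwa [uIcc_of_le ht])
  have h2 : 0 ≤ ∫ s in (0 : ℝ)..t, E s * (u s - w s) := by
    apply intervalIntegral.integral_nonneg_of_ae_restrict ht
    filter_upwards [huw, ae_restrict_mem measurableSet_Icc] with s hs hs'
    exact mul_nonneg (by linarith [(hE 0 s le_rfl hs'.1 hs'.2).1]) (by linarith)
  have h3 : ∫ s in (0 : ℝ)..t, E s * (u s - w s) ≤ ∫ s in (0 : ℝ)..t, E t * (u s - w s) := by
    apply intervalIntegral.integral_mono_ae_restrict ht hi (hsub.const_mul _)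
    filter_upwards [huw, ae_restrict_mem measurableSet_Icc] with s hs hs'
    exact mul_le_mul_of_nonneg_right (hE s t hs'.1 hs'.2 le_rfl).1 (by linarith)
  rw [intervalIntegral.integral_const_mul] at h3
  constructor
  · have := nonneg_of_mul_nonneg_right (h1 ▸ h2) (by linarith : 0 < E t)
    linarith
  · exact le_of_mul_le_mul_left (h1 ▸ h3) (by linarith : 0 < E t)

/-- The state decays at most exponentially, and it controls the mass of the control. -/
lemma state_growth {F : ℝ → ℝ} (hF : IsLakeDrift F) {K : ℝ} (hK : 0 < K)
    (hLip : ∀ a ∈ Ici (0 : ℝ), ∀ b ∈ Ici (0 : ℝ), |F a - F b| ≤ K * |a - b|)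
    {x₀ : ℝ} (hx₀ : 0 ≤ x₀) {u : ℝ → ℝ} (hu : u ∈ Admissible) {t : ℝ} (ht : 0 ≤ t) :
    (∀ s ∈ Icc 0 t, state F x₀ u s ≤ Real.exp (K * (t - s)) * state F x₀ u t) ∧
      ∫ s in (0 : ℝ)..t, u s ≤ Real.exp (K * t) * state F x₀ u t := by
  have hy : IsTrajectoryOn F 0 0 t 0 := ⟨continuousOn_const, fun t _ => by simp [hF.map_zero]⟩
  have hui := admissible_intervalIntegrable hu le_rfl ht
  obtain ⟨E, hEc, hE0, hE, heq⟩ := exists_weight (S := Ici 0) hF.continuous hF.antitone hK.le hLip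
    hui (intervalIntegrable_const (c := (0 : ℝ)))
    ((isTrajectory_state hF hx₀ hu).on t) hy (fun t ht => state_nonneg hF hx₀ hu ht.1)
    (fun t ht => by simp)
  simp only [sub_zero, Pi.zero_apply] at heq
  have hx : ∀ s ∈ Icc 0 t, 0 ≤ state F x₀ u s := fun s hs => state_nonneg hF hx₀ hu hs.1
  have hi : ∀ r s, 0 ≤ r → r ≤ s → s ≤ t →
      IntervalIntegrable (fun s => E s * u s) volume r s := fun r s h1 h2 h3 =>
    (admissible_intervalIntegrable hu h1 (h1.trans h2)).continuousOn_mul (hEc.mono (by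
      rw [uIcc_of_le h2]; exact Icc_subset_Icc h1 h3))
  have ht' : t ∈ Icc 0 t := ⟨ht, le_rfl⟩
  constructor
  · intro s hs
    have h1 := intervalIntegral.integral_add_adjacent_intervals (hi 0 s le_rfl hs.1 hs.2)
      (hi s t hs.1 hs.2 le_rfl)
    have h2 : 0 ≤ ∫ r in s..t, E r * u r := by
      apply intervalIntegral.integral_nonneg_of_ae_restrict hs.2
      filter_upwards [admissible_ae_pos hu (s := Icc s t) (fun r hr => hs.1.trans hr.1),
        ae_restrict_mem measurableSet_Icc] with r hr hr'
      exact mul_nonneg (by linarith [(hE 0 r le_rfl (hs.1.trans hr'.1) hr'.2).1]) hr.le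
    have h3 : E s * state F x₀ u s ≤ E t * state F x₀ u t := by
      rw [heq s hs, heq t ht']; linarith
    have h4 := mul_le_mul_of_nonneg_right (hE s t hs.1 hs.2 le_rfl).2 (hx t ht')
    have h5 := (hE 0 s le_rfl hs.1 hs.2).1
    refine le_of_mul_le_mul_left (h3.trans (h4.trans_eq ?_)) (by linarith : 0 < E s)
    ring
  · have h1 : ∫ s in (0 : ℝ)..t, u s ≤ ∫ s in (0 : ℝ)..t, E s * u s := by
      apply intervalIntegral.integral_mono_ae_restrict ht hui (hi 0 t le_rfl ht le_rfl)
      filter_upwards [admissible_ae_pos hu (s := Icc 0 t) Icc_subset_Ici_self,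
        ae_restrict_mem measurableSet_Icc] with r hr hr'
      nlinarith [(hE 0 r le_rfl hr'.1 hr'.2).1]
    have h2 := (hE 0 t le_rfl ht le_rfl).2
    rw [hE0, mul_one, sub_zero] at h2
    have h3 := mul_le_mul_of_nonneg_right h2 (hx t ht')
    rw [heq t ht'] at h3
    linarith

/-! ### Upper bounds for the payoff -/

lemma integrableOn_Ioi_of_forall_intervalIntegral_le {g : ℝ → ℝ} {a C : ℝ}
    (hg : ∀ᵐ t ∂(volume.restrict (Ioi a)), 0 ≤ g t)
    (hgi : ∀ b, a ≤ b → IntervalIntegrable g volume a b)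
    (hC : ∀ b, a ≤ b → ∫ t in a..b, g t ≤ C) :
    IntegrableOn g (Ioi a) ∧ ∫ t in Ioi a, g t ≤ C := by
  have h1 : IntegrableOn g (Ioi a) := by
    refine integrableOn_Ioi_of_intervalIntegral_norm_bounded (l := atTop) (b := id) C a
      (fun i => ?_) tendsto_id ?_
    · rcases le_total a i with h | h
      · exact (intervalIntegrable_iff_integrableOn_Ioc_of_le h).1 (hgi i h)
      · simp [Ioc_eq_empty (not_lt.2 h)]
    · filter_upwards [eventually_ge_atTop a] with b hb
      refine le_trans (le_of_eq ?_) (hC b hb)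
      apply intervalIntegral.integral_congr_ae_restrict
      simp only [id, uIoc_of_le hb]
      filter_upwards [ae_restrict_of_ae_restrict_of_subset Ioc_subset_Ioi_self hg] with t ht
      simpa using abs_of_nonneg ht
  refine ⟨h1, le_of_tendsto (intervalIntegral_tendsto_integral_Ioi a h1 tendsto_id) ?_⟩
  filter_upwards [eventually_ge_atTop a] with b hb using hC b hb

/-- The discounted integral of `u / (1 + x²)` is bounded independently of the control: up to a
bounded term, `u / (1 + x²)` is the derivative of the bounded function `arctan x`. -/
lemma exists_integral_control_div_le {F : ℝ → ℝ} (hF : IsLakeDrift F) {ρ x₀ : ℝ} (hρ : 0 < ρ)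
    (hx₀ : 0 ≤ x₀) : ∃ C : ℝ, 0 ≤ C ∧ ∀ u ∈ Admissible, ∀ T, 0 ≤ T →
      IntegrableOn (fun t => Real.exp (-ρ * t) * (u t / (1 + state F x₀ u t ^ 2))) (Ioi T) ∧
      ∫ t in Ioi T, Real.exp (-ρ * t) * (u t / (1 + state F x₀ u t ^ 2)) ≤
        C * Real.exp (-ρ * T) := by
  obtain ⟨K, hK, hLip⟩ := hF.exists_lipschitz
  refine ⟨4 + K / ρ, by positivity, fun u hu T hT => ?_⟩
  have hx := isTrajectory_state hF hx₀ hu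
  set x := state F x₀ u with hxdef
  have hxc : ContinuousOn x (Ici 0) := hx.1
  have hac : Continuous fun y : ℝ => (1 + y ^ 2)⁻¹ :=
    (by fun_prop : Continuous fun y : ℝ => 1 + y ^ 2).inv₀ fun y => by positivity
  have hgi : ∀ S, T ≤ S → IntervalIntegrable
      (fun t => Real.exp (-ρ * t) * (u t / (1 + x t ^ 2))) volume T S := by
    intro S hS
    have h1 : ContinuousOn (fun t => (1 + x t ^ 2)⁻¹) (uIcc T S) :=
      (hac.comp_continuousOn hxc).mono fun t ht => (le_inf hT (hT.trans hS)).trans ht.1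
    exact ((admissible_intervalIntegrable hu hT (hT.trans hS)).mul_continuousOn h1).continuousOn_mul
      (by fun_prop)
  refine integrableOn_Ioi_of_forall_intervalIntegral_le ?_ hgi fun S hS => ?_
  · filter_upwards [admissible_ae_pos hu (s := Ioi T) fun t ht => hT.trans (le_of_lt ht)] with t ht
    positivity
  have hS0 : 0 ≤ S := hT.trans hS
  have hTS : uIcc T S ⊆ uIcc 0 S := by
    rw [uIcc_of_le hS, uIcc_of_le hS0]; exact Icc_subset_Icc_left hT
  have h0 : (0 : ℝ) ∈ uIcc 0 S := left_mem_uIcc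
  have hg : IntervalIntegrable (fun s => F (x s) + u s) volume 0 S :=
    (intervalIntegrable_comp_state hF hx₀ hu hF.continuous le_rfl hS0).add
      (admissible_intervalIntegrable hu le_rfl hS0)
  have hP : AbsolutelyContinuousOnInterval
      (fun t => x₀ + ∫ s in (0 : ℝ)..t, (F (x s) + u s)) 0 S := by
    have h2 : AbsolutelyContinuousOnInterval (fun _ : ℝ => x₀) 0 S :=
      (contDiff_const (n := 1)).contDiffOn.absolutelyContinuousOnInterval
    exact h2.add (hg.absolutelyContinuousOnInterval_intervalIntegral h0)
  have hatan : LipschitzOnWith 1 Real.arctan univ := by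
    rw [lipschitzOnWith_univ]
    refine lipschitzWith_of_nnnorm_deriv_le Real.differentiable_arctan fun y => ?_
    rw [← NNReal.coe_le_coe, coe_nnnorm, Real.norm_eq_abs, Real.deriv_arctan]
    have : 1 / (1 + y ^ 2) ≤ 1 := by
      rw [div_le_one (by positivity)]; nlinarith [sq_nonneg y]
    rwa [abs_of_nonneg (by positivity)]
  have hA := (absolutelyContinuousOnInterval_comp hatan hP (fun _ _ => mem_univ _)).mono hTS
  have hE : AbsolutelyContinuousOnInterval (fun t => Real.exp (-ρ * t)) T S :=
    (by fun_prop : ContDiff ℝ 1 fun t => Real.exp (-ρ * t)).contDiffOn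
      |>.absolutelyContinuousOnInterval
  have key := hE.integral_deriv_mul_eq_sub hA
  simp only [← hx.2 S hS0, ← hx.2 T hT] at key
  have hdE : ∀ t, deriv (fun t => Real.exp (-ρ * t)) t = Real.exp (-ρ * t) * -ρ := fun t => by
    have : HasDerivAt (fun t => Real.exp (-ρ * t)) (Real.exp (-ρ * t) * (-ρ * 1)) t :=
      ((hasDerivAt_id t).const_mul (-ρ)).exp
    simpa using this.deriv
  have hxnn : ∀ t, 0 ≤ t → 0 ≤ x t := fun t ht => state_nonneg hF hx₀ hu ht
  have hFx : ∀ t, 0 ≤ t → -(F (x t) / (1 + x t ^ 2)) ≤ K := by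
    intro t ht
    have h1 := hLip (x t) (hxnn t ht) 0 (by simp)
    rw [hF.map_zero, sub_zero, sub_zero, abs_of_nonneg (hxnn t ht)] at h1
    rw [← neg_div, div_le_iff₀ (by positivity)]
    have h3 := neg_le_abs (F (x t))
    nlinarith [sq_nonneg (x t - 1), hxnn t ht]
  have hatan2 : ∀ y, |Real.arctan y| ≤ 2 := fun y => abs_le.2
    ⟨by linarith [Real.neg_pi_div_two_lt_arctan y, Real.pi_le_four],
     by linarith [Real.arctan_lt_pi_div_two y, Real.pi_le_four]⟩
  have h5 : ∫ t in T..S, Real.exp (-ρ * t) * (u t / (1 + x t ^ 2)) ≤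
      ∫ t in T..S, ((deriv (fun t => Real.exp (-ρ * t)) t *
        Real.arctan (x₀ + ∫ s in (0 : ℝ)..t, (F (x s) + u s)) + Real.exp (-ρ * t) *
        deriv (fun t => Real.arctan (x₀ + ∫ s in (0 : ℝ)..t, (F (x s) + u s))) t) +
        (2 + K / ρ) * -deriv (fun t => Real.exp (-ρ * t)) t) := by
    apply intervalIntegral.integral_mono_ae_restrict hS (hgi S hS)
    · exact ((hE.intervalIntegrable_deriv.mul_continuousOn hA.continuousOn).add
        (hA.intervalIntegrable_deriv.continuousOn_mul hE.continuousOn)).add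
        (hE.intervalIntegrable_deriv.neg.const_mul _)
    · filter_upwards [ae_restrict_of_ae hg.ae_hasDerivAt_integral,
        ae_restrict_mem measurableSet_Icc] with t h2 ht
      have ht' : t ∈ uIcc 0 S := hTS (by rwa [uIcc_of_le hS])
      have ht0 : 0 ≤ t := hT.trans ht.1
      have h4 := ((h2 ht' 0 h0).const_add x₀).arctan.deriv
      rw [h4, ← hx.2 t ht0, hdE]
      have h6 := (abs_le.1 (hatan2 (x t))).2
      have h7 := hFx t ht0
      have h8 := Real.exp_pos (-ρ * t)
      have h9 : (2 + K / ρ) * -(Real.exp (-ρ * t) * -ρ) = Real.exp (-ρ * t) * (2 * ρ + K) := by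
        field_simp
      have h10 : 1 / (1 + x t ^ 2) * (F (x t) + u t) =
        u t / (1 + x t ^ 2) + F (x t) / (1 + x t ^ 2) := by ring
      rw [h9, h10]
      have h11 : 0 ≤ ρ * (2 - Real.arctan (x t)) + (K + F (x t) / (1 + x t ^ 2)) :=
        add_nonneg (mul_nonneg hρ.le (by linarith)) (by linarith)
      nlinarith [mul_nonneg h8.le h11]
  refine h5.trans ?_
  rw [intervalIntegral.integral_add, key, intervalIntegral.integral_const_mul,
    intervalIntegral.integral_neg, hE.integral_deriv_eq_sub]
  · have h6 := (abs_le.1 (hatan2 (x S))).2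
    have h7 := (abs_le.1 (hatan2 (x T))).1
    have h7' : 0 ≤ Real.arctan (x T) := Real.arctan_nonneg.2 (hxnn T hT)
    have h8 := Real.exp_pos (-ρ * S)
    have h8' := Real.exp_pos (-ρ * T)
    have h9 : Real.exp (-ρ * S) ≤ Real.exp (-ρ * T) := Real.exp_le_exp.2 (by nlinarith)
    have h10 : 0 < K / ρ := by positivity
    nlinarith [mul_le_mul_of_nonneg_left h6 h8.le, mul_nonneg h8'.le h7', mul_pos h8 h10]
  · exact (hE.intervalIntegrable_deriv.mul_continuousOn hA.continuousOn).add
      (hA.intervalIntegrable_deriv.continuousOn_mul hE.continuousOn)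
  · exact hE.intervalIntegrable_deriv.neg.const_mul _

lemma integral_exp_neg_mul_Ioi {ρ : ℝ} (hρ : 0 < ρ) (T : ℝ) :
    ∫ t in Ioi T, Real.exp (-ρ * t) = Real.exp (-ρ * T) / ρ := by
  rw [integral_exp_mul_Ioi (neg_lt_zero.2 hρ)]
  rw [neg_div_neg_eq]

/-- The payoffs of all admissible controls have nonnegative integrable majorants whose tails are
exponentially small, uniformly in the control. -/
lemma exists_payoff_le {F : ℝ → ℝ} (hF : IsLakeDrift F) {ρ c x₀ : ℝ} (hρ : 0 < ρ) (hc : 0 < c)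
    (hx₀ : 0 ≤ x₀) : ∃ C : ℝ, 0 ≤ C ∧ ∀ u ∈ Admissible, ∃ G : ℝ → ℝ,
      (∀ᵐ t ∂(volume.restrict (Ioi 0)), 0 ≤ G t ∧ payoff F ρ c x₀ u t ≤ G t) ∧
      IntegrableOn G (Ioi 0) ∧ ∀ T, 0 ≤ T → ∫ t in Ioi T, G t ≤ C * Real.exp (-ρ * T) := by
  obtain ⟨C, hC, h⟩ := exists_integral_control_div_le hF hρ hx₀
  refine ⟨C + |c - 2 - Real.log c| / ρ, by positivity, fun u hu => ?_⟩
  set D := |c - 2 - Real.log c|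
  have hexp : ∀ T, IntegrableOn (fun t => D * Real.exp (-ρ * t)) (Ioi T) := fun T =>
    (integrableOn_exp_mul_Ioi (neg_lt_zero.2 hρ) T).const_mul D
  refine ⟨fun t => Real.exp (-ρ * t) * (u t / (1 + state F x₀ u t ^ 2)) + D * Real.exp (-ρ * t),
    ?_, (h u hu 0 le_rfl).1.add (hexp 0), fun T hT => ?_⟩
  · filter_upwards [admissible_ae_pos hu (s := Ioi 0) Ioi_subset_Ici_self] with t ht
    refine ⟨by positivity, ?_⟩
    have hy : 0 < 1 + state F x₀ u t ^ 2 := by positivity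
    have h1 := Real.log_le_sub_one_of_pos (div_pos ht hy)
    rw [Real.log_div ht.ne' hy.ne'] at h1
    have h2 := Real.log_le_sub_one_of_pos (mul_pos hc hy)
    rw [Real.log_mul hc.ne' hy.ne'] at h2
    have h3 : c - 2 - Real.log c ≤ D := le_abs_self _
    rw [payoff, mul_comm D, ← mul_add]
    exact mul_le_mul_of_nonneg_left (by linarith) (Real.exp_pos _).le
  · rw [integral_add (h u hu T hT).1 (hexp T), integral_const_mul, integral_exp_neg_mul_Ioi hρ]
    have := (h u hu T hT).2
    rw [add_mul, div_mul_eq_mul_div, mul_div_assoc']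
    linarith

/-! ### The objective functional and the value -/

lemma aestronglyMeasurable_payoff {F : ℝ → ℝ} (hF : IsLakeDrift F) {ρ c x₀ : ℝ} (hx₀ : 0 ≤ x₀)
    {u : ℝ → ℝ} (hu : u ∈ Admissible) :
    AEStronglyMeasurable (payoff F ρ c x₀ u) (volume.restrict (Ioi 0)) := by
  have h1 : AEMeasurable u (volume.restrict (Ioi 0)) :=
    (hu.1.aestronglyMeasurable.aemeasurable).mono_measure
      (Measure.restrict_mono Ioi_subset_Ici_self le_rfl)
  have h2 : AEMeasurable (state F x₀ u) (volume.restrict (Ioi 0)) :=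
    ((continuousOn_state hF hx₀ hu).mono Ioi_subset_Ici_self).aemeasurable measurableSet_Ioi
  unfold payoff
  exact ((by fun_prop : Measurable fun t => Real.exp (-ρ * t)).aemeasurable.mul
    (h1.log.sub ((h2.pow_const 2).const_mul c))).aestronglyMeasurable

lemma objective_eq_integral {F : ℝ → ℝ} {ρ c x₀ : ℝ} {u : ℝ → ℝ}
    (h : IntegrableOn (payoff F ρ c x₀ u) (Ioi 0)) :
    objective F ρ c x₀ u = ((∫ t in Ioi 0, payoff F ρ c x₀ u t : ℝ) : EReal) := by
  have h1 : ∫⁻ t in Ioi (0 : ℝ), ENNReal.ofReal (payoff F ρ c x₀ u t) ≠ ⊤ :=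
    (h.lintegral_lt_top).ne
  have h2 : ∫⁻ t in Ioi (0 : ℝ), ENNReal.ofReal (-payoff F ρ c x₀ u t) ≠ ⊤ :=
    (Integrable.lintegral_lt_top h.neg).ne
  rw [objective, integral_eq_lintegral_pos_part_sub_lintegral_neg_part h, EReal.coe_sub,
    EReal.coe_ennreal_toReal h1, EReal.coe_ennreal_toReal h2]

lemma integrableOn_payoff {F : ℝ → ℝ} (hF : IsLakeDrift F) {ρ c x₀ : ℝ} (hρ : 0 < ρ) (hc : 0 < c)
    (hx₀ : 0 ≤ x₀) {u : ℝ → ℝ} (hu : u ∈ Admissible) (h : ⊥ < objective F ρ c x₀ u) :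
    IntegrableOn (payoff F ρ c x₀ u) (Ioi 0) := by
  obtain ⟨C, hC, hG⟩ := exists_payoff_le hF hρ hc hx₀
  obtain ⟨G, hG1, hG2, -⟩ := hG u hu
  have hm := aestronglyMeasurable_payoff hF (ρ := ρ) (c := c) hx₀ hu
  have hneg : ∫⁻ t in Ioi (0 : ℝ), ENNReal.ofReal (-payoff F ρ c x₀ u t) ≠ ⊤ := by
    intro htop
    rw [objective, htop] at h
    simp at h
  have hint : IntegrableOn (fun t => max (-payoff F ρ c x₀ u t) 0) (Ioi 0) := by
    refine ⟨(hm.neg.aemeasurable.max aemeasurable_const).aestronglyMeasurable, ?_⟩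
    rw [hasFiniteIntegral_iff_ofReal (f := fun t => max (-payoff F ρ c x₀ u t) 0)
      (Eventually.of_forall fun t => le_max_right _ _)]
    refine lt_of_le_of_lt (le_of_eq ?_) (lt_top_iff_ne_top.2 hneg)
    refine lintegral_congr fun t => ?_
    rcases le_total (-payoff F ρ c x₀ u t) 0 with h1 | h1
    · rw [max_eq_right h1, ENNReal.ofReal_of_nonpos h1, ENNReal.ofReal_zero]
    · rw [max_eq_left h1]
  refine Integrable.mono' (hG2.add hint) hm ?_
  filter_upwards [hG1] with t ht
  rw [Real.norm_eq_abs, abs_le, Pi.add_apply]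
  constructor
  · linarith [le_max_left (-payoff F ρ c x₀ u t) 0]
  · linarith [le_max_right (-payoff F ρ c x₀ u t) 0]

/-- An integrable minorant of the payoff bounds the objective from below: the payoff always has an
integrable majorant, so it is then integrable. -/
lemma integral_le_objective {F : ℝ → ℝ} (hF : IsLakeDrift F) {ρ c x₀ : ℝ} (hρ : 0 < ρ) (hc : 0 < c)
    (hx₀ : 0 ≤ x₀) {u g : ℝ → ℝ} (hu : u ∈ Admissible) (hg : IntegrableOn g (Ioi 0))
    (hle : ∀ᵐ t ∂(volume.restrict (Ioi 0)), g t ≤ payoff F ρ c x₀ u t) :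
    ((∫ t in Ioi 0, g t : ℝ) : EReal) ≤ objective F ρ c x₀ u := by
  obtain ⟨C, hC, hG⟩ := exists_payoff_le hF hρ hc hx₀
  obtain ⟨G, hG1, hG2, -⟩ := hG u hu
  have h : IntegrableOn (payoff F ρ c x₀ u) (Ioi 0) := by
    refine Integrable.mono' (hg.norm.add hG2) (aestronglyMeasurable_payoff hF hx₀ hu) ?_
    filter_upwards [hle, hG1] with t h1 h2
    rw [Pi.add_apply, Real.norm_eq_abs, Real.norm_eq_abs, abs_le]
    constructor
    · linarith [neg_abs_le (g t)]
    · linarith [abs_nonneg (g t)]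
  rw [objective_eq_integral h]
  exact_mod_cast integral_mono_ae hg h hle

lemma objective_le_value {F : ℝ → ℝ} {ρ c x₀ : ℝ} {u : ℝ → ℝ} (hu : u ∈ Admissible) :
    objective F ρ c x₀ u ≤ value F ρ c x₀ :=
  le_iSup₂ (f := fun u (_ : u ∈ Admissible) => objective F ρ c x₀ u) u hu

lemma value_ne_top {F : ℝ → ℝ} (hF : IsLakeDrift F) {ρ c x₀ : ℝ} (hρ : 0 < ρ) (hc : 0 < c)
    (hx₀ : 0 ≤ x₀) : value F ρ c x₀ ≠ ⊤ := by
  obtain ⟨C, hC, hG⟩ := exists_payoff_le hF hρ hc hx₀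
  refine ne_top_of_le_ne_top (EReal.coe_ne_top C) (iSup₂_le fun u hu => ?_)
  rcases eq_or_ne (objective F ρ c x₀ u) ⊥ with h | h
  · rw [h]; exact bot_le
  have hi := integrableOn_payoff hF hρ hc hx₀ hu (bot_lt_iff_ne_bot.2 h)
  obtain ⟨G, hG1, hG2, hG3⟩ := hG u hu
  rw [objective_eq_integral hi]
  have h1 := integral_mono_ae hi hG2 (hG1.mono fun t ht => ht.2)
  have h2 := hG3 0 le_rfl
  rw [mul_zero, Real.exp_zero, mul_one] at h2
  exact_mod_cast h1.trans h2

lemma one_mem_admissible : (fun _ => 1 : ℝ → ℝ) ∈ Admissible :=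
  admissible_iff.2 ⟨fun _ => integrableOn_const (by simp), by simp⟩

lemma value_ne_bot {F : ℝ → ℝ} (hF : IsLakeDrift F) {ρ c x₀ : ℝ} (hρ : 0 < ρ) (hc : 0 < c)
    (hx₀ : 0 ≤ x₀) : value F ρ c x₀ ≠ ⊥ := by
  have hu := one_mem_admissible
  have h1 : IntegrableOn (fun t : ℝ => -c * (Real.exp (-ρ * t) * (x₀ + t) ^ 2)) (Ioi 0) := by
    apply Integrable.const_mul
    have h2 : ∀ n : ℕ, IntegrableOn (fun t : ℝ => t ^ n * Real.exp (-ρ * t)) (Ioi 0) := by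
      intro n
      have := integrableOn_rpow_mul_exp_neg_mul_rpow (p := 1) (s := n) (b := ρ)
        (by have : (0 : ℝ) ≤ n := n.cast_nonneg
            linarith) zero_lt_one hρ
      simpa using this
    have h3 := (((h2 0).const_mul (x₀ ^ 2)).add ((h2 1).const_mul (2 * x₀))).add (h2 2)
    refine h3.congr (Eventually.of_forall fun t => ?_)
    simp only [Pi.add_apply]
    ring
  have h2 : ∀ᵐ t ∂(volume.restrict (Ioi 0)),
      -c * (Real.exp (-ρ * t) * (x₀ + t) ^ 2) ≤ payoff F ρ c x₀ (fun _ => 1) t := by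
    filter_upwards [ae_restrict_mem measurableSet_Ioi] with t ht
    have ht0 : 0 ≤ t := le_of_lt ht
    have h3 := state_le hF hx₀ hu ht0
    have h4 := state_nonneg hF hx₀ hu ht0
    simp only [intervalIntegral.integral_const, sub_zero, smul_eq_mul, mul_one] at h3
    have h5 : state F x₀ (fun _ => 1) t ^ 2 ≤ (x₀ + t) ^ 2 := pow_le_pow_left₀ h4 h3 2
    rw [payoff, Real.log_one, zero_sub]
    nlinarith [mul_le_mul_of_nonneg_left h5 (mul_pos hc (Real.exp_pos (-ρ * t))).le]
  exact ne_bot_of_le_ne_bot (EReal.coe_ne_bot _)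
    ((integral_le_objective hF hρ hc hx₀ hu h1 h2).trans (objective_le_value hu))

lemma exists_value_eq {F : ℝ → ℝ} (hF : IsLakeDrift F) {ρ c x₀ : ℝ} (hρ : 0 < ρ) (hc : 0 < c)
    (hx₀ : 0 ≤ x₀) : ∃ V : ℝ, value F ρ c x₀ = (V : EReal) :=
  ⟨_, (EReal.coe_toReal (value_ne_top hF hρ hc hx₀) (value_ne_bot hF hρ hc hx₀)).symm⟩

lemma exists_isMaximizing {F : ℝ → ℝ} (hF : IsLakeDrift F) {ρ c x₀ : ℝ} (hρ : 0 < ρ) (hc : 0 < c)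
    (hx₀ : 0 ≤ x₀) : ∃ u : ℕ → ℝ → ℝ, IsMaximizing F ρ c x₀ u ∧
      ∀ n, value F ρ c x₀ - 1 < objective F ρ c x₀ (u n) := by
  obtain ⟨V, hV⟩ := exists_value_eq hF hρ hc hx₀
  have h : ∀ n : ℕ, ∃ u ∈ Admissible, ((V - 1 / ((n : ℝ) + 1) : ℝ) : EReal) <
      objective F ρ c x₀ u := by
    intro n
    have h1 : ((V - 1 / ((n : ℝ) + 1) : ℝ) : EReal) < value F ρ c x₀ := by
      rw [hV, EReal.coe_lt_coe_iff]
      have : (0 : ℝ) < 1 / ((n : ℝ) + 1) := by positivity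
      linarith
    rw [value] at h1
    obtain ⟨u, hu⟩ := lt_iSup_iff.1 h1
    obtain ⟨hu1, hu2⟩ := lt_iSup_iff.1 hu
    exact ⟨u, hu1, hu2⟩
  choose u hu hlt using h
  refine ⟨u, ⟨hu, ?_⟩, fun n => lt_of_le_of_lt ?_ (hlt n)⟩
  · refine tendsto_of_tendsto_of_tendsto_of_le_of_le (h := fun _ => value F ρ c x₀) ?_
      tendsto_const_nhds (fun n => (hlt n).le) fun n => objective_le_value (hu n)
    rw [hV]
    refine (continuous_coe_real_ereal.tendsto V).comp ?_
    simpa using tendsto_one_div_add_atTop_nhds_zero_nat.const_sub V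
  · rw [hV]
    have h1 : (1 : ℝ) / ((n : ℝ) + 1) ≤ 1 := by
      rw [div_le_one (by positivity)]
      linarith [(n.cast_nonneg : (0 : ℝ) ≤ n)]
    have h2 : ((V : EReal) - 1) = ((V - 1 : ℝ) : EReal) := by simp
    rw [h2]
    exact_mod_cast (by linarith : V - 1 ≤ V - 1 / ((n : ℝ) + 1))

lemma bot_lt_objective {F : ℝ → ℝ} {ρ c x₀ : ℝ} {u : ℝ → ℝ}
    (h : value F ρ c x₀ - 1 < objective F ρ c x₀ u) : ⊥ < objective F ρ c x₀ u :=
  bot_le.trans_lt h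

/-- Controls whose payoff is close to the value have uniformly bounded discounted quadratic cost.
This follows from the upper bound for the payoff with half of the cost coefficient. -/
lemma exists_integral_sq_le {F : ℝ → ℝ} (hF : IsLakeDrift F) {ρ c x₀ : ℝ} (hρ : 0 < ρ) (hc : 0 < c)
    (hx₀ : 0 ≤ x₀) : ∃ C : ℝ, 0 < C ∧ ∀ u ∈ Admissible,
      value F ρ c x₀ - 1 < objective F ρ c x₀ u →
      IntegrableOn (fun t => Real.exp (-ρ * t) * state F x₀ u t ^ 2) (Ioi 0) ∧
      ∫ t in Ioi 0, Real.exp (-ρ * t) * state F x₀ u t ^ 2 ≤ C := by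
  obtain ⟨V, hV⟩ := exists_value_eq hF hρ hc hx₀
  obtain ⟨C, hC, hG⟩ := exists_payoff_le hF hρ (half_pos hc) hx₀
  refine ⟨2 / c * max (C + 1 - V) 1, by positivity, fun u hu hlt => ?_⟩
  obtain ⟨G, hG1, hG2, hG3⟩ := hG u hu
  have hi := integrableOn_payoff hF hρ hc hx₀ hu (bot_lt_objective hlt)
  rw [objective_eq_integral hi, hV] at hlt
  have hlt' : V - 1 < ∫ t in Ioi 0, payoff F ρ c x₀ u t := by
    have : ((V - 1 : ℝ) : EReal) < ((∫ t in Ioi 0, payoff F ρ c x₀ u t : ℝ) : EReal) := by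
      simpa using hlt
    exact_mod_cast this
  have h1 : IntegrableOn (fun t => 2 / c * (G t - payoff F ρ c x₀ u t)) (Ioi 0) :=
    (hG2.sub hi).const_mul _
  have hx : AEStronglyMeasurable (fun t => Real.exp (-ρ * t) * state F x₀ u t ^ 2)
      (volume.restrict (Ioi 0)) := by
    refine ContinuousOn.aestronglyMeasurable ?_ measurableSet_Ioi
    exact (by fun_prop : Continuous fun t => Real.exp (-ρ * t)).continuousOn.mul
      (((continuousOn_state hF hx₀ hu).mono Ioi_subset_Ici_self).pow 2)
  have h2 : ∀ᵐ t ∂(volume.restrict (Ioi 0)), Real.exp (-ρ * t) * state F x₀ u t ^ 2 ≤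
      2 / c * (G t - payoff F ρ c x₀ u t) := by
    filter_upwards [hG1] with t ht
    have h3 := ht.2
    rw [payoff] at h3 ⊢
    rw [div_mul_eq_mul_div, le_div_iff₀ hc]
    linarith
  have h3 : IntegrableOn (fun t => Real.exp (-ρ * t) * state F x₀ u t ^ 2) (Ioi 0) := by
    refine Integrable.mono' h1 hx ?_
    filter_upwards [h2] with t ht
    rwa [Real.norm_eq_abs, abs_of_nonneg (by positivity)]
  refine ⟨h3, (integral_mono_ae h3 h1 h2).trans ?_⟩
  rw [integral_const_mul, integral_sub hG2 hi]
  have h4 := hG3 0 le_rfl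
  rw [mul_zero, Real.exp_zero, mul_one] at h4
  gcongr
  exact le_trans (by linarith) (le_max_left _ _)

/-- Controls whose payoff is close to the value have locally uniformly bounded mass. -/
lemma exists_integral_control_le {F : ℝ → ℝ} (hF : IsLakeDrift F) {ρ c x₀ : ℝ} (hρ : 0 < ρ)
    (hc : 0 < c) (hx₀ : 0 ≤ x₀) : ∃ A a : ℝ, 0 < A ∧ 0 < a ∧ ∀ u ∈ Admissible,
      value F ρ c x₀ - 1 < objective F ρ c x₀ u → ∀ T, 0 ≤ T →
      ∫ t in (0 : ℝ)..T, u t ≤ A * Real.exp (a * T) := by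
  obtain ⟨K, hK, hLip⟩ := hF.exists_lipschitz
  obtain ⟨C, hC, h⟩ := exists_integral_sq_le hF hρ hc hx₀
  refine ⟨Real.exp (2 * K) * Real.exp ρ * C + 1, K + ρ, by positivity, by positivity,
    fun u hu hlt T hT => ?_⟩
  obtain ⟨hi, hle⟩ := h u hu hlt
  set x := state F x₀ u
  have hx : 0 ≤ x T := state_nonneg hF hx₀ hu hT
  -- the state cannot drop much in `[T, T + 1]`, so its square is controlled by the integral
  have h1 : Real.exp (-ρ * (T + 1)) * (Real.exp (-(2 * K)) * x T ^ 2) ≤ C := by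
    have h2 : ∫ t in T..(T + 1), Real.exp (-ρ * (T + 1)) * (Real.exp (-(2 * K)) * x T ^ 2) ≤
        ∫ t in T..(T + 1), Real.exp (-ρ * t) * x t ^ 2 := by
      refine intervalIntegral.integral_mono_on (by linarith) intervalIntegrable_const
        ?_ fun t ht => ?_
      · rw [intervalIntegrable_iff_integrableOn_Ioc_of_le (by linarith)]
        exact hi.mono_set fun t ht => hT.trans_lt ht.1
      · have ht0 : 0 ≤ t := hT.trans ht.1
        have h3 := (state_growth hF hK hLip hx₀ hu ht0).1 T ⟨hT, ht.1⟩
        have h4 : x T ≤ Real.exp K * x t := by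
          refine h3.trans (mul_le_mul_of_nonneg_right (Real.exp_le_exp.2 ?_)
            (state_nonneg hF hx₀ hu ht0))
          nlinarith [ht.2]
        have h5 : x T ^ 2 ≤ Real.exp (2 * K) * x t ^ 2 := by
          calc x T ^ 2 ≤ (Real.exp K * x t) ^ 2 := pow_le_pow_left₀ hx h4 2
            _ = _ := by rw [mul_pow, ← Real.exp_nat_mul]; norm_num
        have h6 : Real.exp (-(2 * K)) * x T ^ 2 ≤ x t ^ 2 := by
          rw [Real.exp_neg, inv_mul_le_iff₀ (Real.exp_pos _)]
          exact h5
        have h7 : Real.exp (-ρ * (T + 1)) ≤ Real.exp (-ρ * t) :=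
          Real.exp_le_exp.2 (by nlinarith [ht.2])
        exact mul_le_mul h7 h6 (by positivity) (Real.exp_pos _).le
    rw [intervalIntegral.integral_const, add_sub_cancel_left, one_smul,
      intervalIntegral.integral_of_le (by linarith)] at h2
    refine h2.trans (le_trans ?_ hle)
    refine setIntegral_mono_set hi (Eventually.of_forall fun t => by positivity) ?_
    exact (Ioc_subset_Ioi_self.trans (Ioi_subset_Ioi hT)).eventuallyLE
  have h2 := (state_growth hF hK hLip hx₀ hu hT).2
  have h3 : x T ^ 2 ≤ Real.exp (2 * K) * Real.exp ρ * C * Real.exp (ρ * T) := by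
    have h4 : Real.exp (-ρ * (T + 1)) * Real.exp (-(2 * K)) *
      (Real.exp (2 * K) * Real.exp ρ * Real.exp (ρ * T)) = 1 := by
      rw [← Real.exp_add, ← Real.exp_add, ← Real.exp_add, ← Real.exp_add,
        Real.exp_eq_one_iff]
      ring
    have h5 := mul_le_mul_of_nonneg_right h1
      (by positivity : 0 ≤ Real.exp (2 * K) * Real.exp ρ * Real.exp (ρ * T))
    calc x T ^ 2 = Real.exp (-ρ * (T + 1)) * Real.exp (-(2 * K)) *
      (Real.exp (2 * K) * Real.exp ρ * Real.exp (ρ * T)) * x T ^ 2 := by rw [h4, one_mul]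
      _ ≤ _ := by linarith
  have h4 : x T ≤ (Real.exp (2 * K) * Real.exp ρ * C + 1) * Real.exp (ρ * T) := by
    have h5 : 1 ≤ Real.exp (ρ * T) := Real.one_le_exp (by positivity)
    nlinarith [sq_nonneg (x T - 1)]
  refine h2.trans ((mul_le_mul_of_nonneg_left h4 (Real.exp_pos _).le).trans_eq ?_)
  rw [add_mul K ρ T, Real.exp_add]
  ring

/-! ### Localization -/

/-- Cutting a control off at a high level `N` on `[0, T]` can be compensated by adding a constant
control, in an amount fixed by the removed mass, on `(T, T + 1]`. The state does not increase, and
the logarithmic gain on `(T, T + 1]` outweighs the loss when `N` is large compared with the mass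
`M` of the control. -/
lemma exists_upper_truncation {F : ℝ → ℝ} (hF : IsLakeDrift F) {ρ c x₀ : ℝ} (hρ : 0 < ρ)
    (hc : 0 < c) (hx₀ : 0 ≤ x₀) {K : ℝ} (hK : 0 < K)
    (hLip : ∀ a ∈ Ici (0 : ℝ), ∀ b ∈ Ici (0 : ℝ), |F a - F b| ≤ K * |a - b|)
    {u : ℝ → ℝ} (hu : u ∈ Admissible) (hbot : ⊥ < objective F ρ c x₀ u) {T M N : ℝ} (hT : 0 ≤ T)
    (hM : 0 < M) (hmass : ∫ t in (0 : ℝ)..(T + 1), u t ≤ M)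
    (hN : M * Real.exp ((ρ + K) * (T + 1)) ≤ N) :
    ∃ w ∈ Admissible, objective F ρ c x₀ u ≤ objective F ρ c x₀ w ∧
      ∀ᵐ t ∂(volume.restrict (Icc 0 T)), w t = min (u t) N := by
  have hN0 : 0 < N := lt_of_lt_of_le (by positivity) hN
  set J : ℝ := ∫ t in (0 : ℝ)..T, (u t - min (u t) N) with hJ
  have hT1 : T ≤ T + 1 := by linarith
  have hminI : ∀ S, IntegrableOn (fun t => u t - min (u t) N) (Icc 0 S) := fun S =>
    (admissible_integrableOn_Icc hu S).sub
      ((admissible_integrableOn_Icc hu S).inf (integrable_const N))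
  have hJ0 : 0 ≤ J := intervalIntegral.integral_nonneg hT fun t _ => by simp
  have hJi : IntervalIntegrable (fun t => u t - min (u t) N) volume 0 T :=
    (intervalIntegrable_iff_integrableOn_Icc_of_le hT).2 (hminI T)
  have hJu : J ≤ ∫ t in (0 : ℝ)..T, u t := by
    apply intervalIntegral.integral_mono_ae_restrict hT hJi
      (admissible_intervalIntegrable hu le_rfl hT)
    filter_upwards [admissible_ae_pos hu (s := Icc 0 T) Icc_subset_Ici_self] with t ht
    linarith [le_min ht.le hN0.le]
  set I : ℝ := Real.exp (-(K * (T + 1))) * J with hI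
  have hI0 : 0 ≤ I := by positivity
  have hIJ : I ≤ J := by
    refine mul_le_of_le_one_left hJ0 (Real.exp_le_one_iff.2 ?_)
    have : 0 ≤ K * (T + 1) := by positivity
    linarith
  have hmass1 : (∫ t in T..(T + 1), u t) + I ≤ M := by
    have := intervalIntegral.integral_add_adjacent_intervals
      (admissible_intervalIntegrable hu le_rfl hT)
      (admissible_intervalIntegrable hu hT (by linarith : 0 ≤ T + 1))
    linarith
  set w : ℝ → ℝ := fun t => u t - (Iic T).indicator (fun t => u t - min (u t) N) t +
    (Ioc T (T + 1)).indicator (fun _ => I) t with hw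
  have hw1 : ∀ t, t ≤ T → w t = min (u t) N := fun t ht => by
    simp [hw, ht, indicator_of_mem, not_lt.2 ht]
  have hw2 : ∀ t, T < t → t ≤ T + 1 → w t = u t + I := fun t ht ht' => by
    simp [hw, ht, ht']
  have hw3 : ∀ t, T + 1 < t → w t = u t := fun t ht => by
    have : T < t := by linarith
    simp [hw, not_le.2 ht, this]
  have hwA : w ∈ Admissible := by
    refine admissible_iff.2 ⟨fun n => ?_, ?_⟩
    · refine ((admissible_integrableOn_Icc hu n).sub ((hminI n).indicator measurableSet_Iic)).add ?_
      exact (integrable_const I).indicator measurableSet_Ioc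
    · filter_upwards [hu.2] with t ht
      rcases le_or_gt t T with h | h
      · rw [hw1 t h]; exact lt_min ht hN0
      · rcases le_or_gt t (T + 1) with h' | h'
        · rw [hw2 t h h']; linarith
        · rwa [hw3 t h']
  -- `E` is at least `1` on `[0, T]`, where the control is lowered, and at most `e^{K (T + 1)}` on
  -- `(T, T + 1]`, where it is raised: this is the reason for the factor in `I`
  have hstate : ∀ t, 0 ≤ t → state F x₀ w t ≤ state F x₀ u t := by
    intro t ht
    rcases le_total t T with htT | htT
    · refine (state_mono hF hx₀ hu hwA ht ?_).1
      filter_upwards [ae_restrict_mem measurableSet_Icc] with s hs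
      rw [hw1 s (hs.2.trans htT)]; exact min_le_left _ _
    obtain ⟨E, hEc, hE0, hE, heq⟩ := exists_weight_state hF hK hLip hx₀ hu hwA ht
    have hi : ∀ r s, 0 ≤ r → r ≤ s → s ≤ t →
        IntervalIntegrable (fun s => E s * (u s - w s)) volume r s := fun r s h1 h2 h3 =>
      ((admissible_intervalIntegrable hu h1 (h1.trans h2)).sub
        (admissible_intervalIntegrable hwA h1 (h1.trans h2))).continuousOn_mul (hEc.mono (by
        rw [uIcc_of_le h2]; exact Icc_subset_Icc h1 h3))
    have h1 : J ≤ ∫ s in (0 : ℝ)..T, E s * (u s - w s) := by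
      refine intervalIntegral.integral_mono_on hT hJi (hi 0 T le_rfl hT htT) fun s hs => ?_
      rw [hw1 s hs.2]
      have h2 := (hE 0 s le_rfl hs.1 (hs.2.trans htT)).1
      rw [hE0] at h2
      exact le_mul_of_one_le_left (by simp) h2
    have h2 : ∀ r, T ≤ r → r ≤ T + 1 → r ≤ t → -J ≤ ∫ s in T..r, E s * (u s - w s) := by
      intro r hr hr' hrt
      have h3 : ∫ s in T..r, -J ≤ ∫ s in T..r, E s * (u s - w s) := by
        refine intervalIntegral.integral_mono_on_of_le_Ioo hr intervalIntegrable_const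
          (hi T r hT hr hrt) fun s hs => ?_
        rw [hw2 s hs.1 (hs.2.le.trans hr')]
        have h4 := (hE 0 s le_rfl (hT.trans hs.1.le) (hs.2.le.trans hrt)).2
        rw [hE0, mul_one, sub_zero] at h4
        have h5 : E s ≤ Real.exp (K * (T + 1)) :=
          h4.trans (Real.exp_le_exp.2 (by nlinarith [hs.2]))
        have h6 : Real.exp (K * (T + 1)) * I = J := by
          rw [hI, ← mul_assoc, ← Real.exp_add, add_neg_cancel, Real.exp_zero, one_mul]
        nlinarith [mul_le_mul_of_nonneg_right h5 hI0]
      rw [intervalIntegral.integral_const, smul_eq_mul] at h3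
      nlinarith
    have h7 : 0 ≤ ∫ s in (0 : ℝ)..t, E s * (u s - w s) := by
      rw [← intervalIntegral.integral_add_adjacent_intervals (hi 0 T le_rfl hT htT)
        (hi T t hT htT le_rfl)]
      rcases le_total t (T + 1) with h | h
      · linarith [h2 t htT h le_rfl]
      · rw [← intervalIntegral.integral_add_adjacent_intervals (hi T (T + 1) hT hT1 h)
          (hi (T + 1) t (by linarith) h le_rfl)]
        have h8 : ∫ s in (T + 1)..t, E s * (u s - w s) = 0 := by
          rw [intervalIntegral.integral_of_le h]
          refine setIntegral_eq_zero_of_forall_eq_zero fun s hs => ?_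
          rw [hw3 s hs.1]; simp
        linarith [h2 (T + 1) hT1 le_rfl h]
    have h8 := heq t ⟨ht, le_rfl⟩
    have h9 := (hE 0 t le_rfl ht le_rfl).1
    have := nonneg_of_mul_nonneg_right (h8 ▸ h7) (by linarith : 0 < E t)
    linarith
  refine ⟨w, hwA, ?_, ?_⟩
  swap
  · filter_upwards [ae_restrict_mem measurableSet_Icc] with t ht using hw1 t ht.2
  have hpi := integrableOn_payoff hF hρ hc hx₀ hu hbot
  -- tangent line estimates for the logarithm give an integrable minorant of the new payoff
  set d₁ : ℝ → ℝ := fun t => -(1 / N) * (u t - min (u t) N) with hd₁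
  set d₂ : ℝ → ℝ := fun t => Real.exp (-ρ * (T + 1)) * (I * (2 / M - (u t + I) / M ^ 2)) with hd₂
  have hd₁i : IntegrableOn d₁ (Ioc 0 T) :=
    ((hminI T).mono_set Ioc_subset_Icc_self).const_mul _
  have hui : IntegrableOn u (Ioc T (T + 1)) :=
    (admissible_intervalIntegrable hu hT (by linarith : 0 ≤ T + 1)).1
  have hdiv : IntegrableOn (fun t => (u t + I) / M ^ 2) (Ioc T (T + 1)) :=
    (hui.add (integrable_const I)).div_const _
  have hd₂i : IntegrableOn d₂ (Ioc T (T + 1)) :=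
    (((integrable_const (2 / M)).sub hdiv).const_mul _).const_mul _
  have hsub₁ : Ioi (0 : ℝ) ∩ Ioc 0 T = Ioc 0 T := inter_eq_right.2 Ioc_subset_Ioi_self
  have hsub₂ : Ioi (0 : ℝ) ∩ Ioc T (T + 1) = Ioc T (T + 1) :=
    inter_eq_right.2 (Ioc_subset_Ioi_self.trans (Ioi_subset_Ioi hT))
  have hi₁ : IntegrableOn ((Ioc 0 T).indicator d₁) (Ioi 0) :=
    (hd₁i.integrable_indicator measurableSet_Ioc).integrableOn
  have hi₂ : IntegrableOn ((Ioc T (T + 1)).indicator d₂) (Ioi 0) :=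
    (hd₂i.integrable_indicator measurableSet_Ioc).integrableOn
  have hi₁₂ : IntegrableOn (fun t => (Ioc 0 T).indicator d₁ t + (Ioc T (T + 1)).indicator d₂ t)
      (Ioi 0) := hi₁.add hi₂
  have hle := integral_le_objective (g := fun t => payoff F ρ c x₀ u t +
    ((Ioc 0 T).indicator d₁ t + (Ioc T (T + 1)).indicator d₂ t)) hF hρ hc hx₀ hwA
    (hpi.add hi₁₂) ?_
  · refine le_trans ?_ hle
    rw [objective_eq_integral hpi, EReal.coe_le_coe_iff, integral_add hpi hi₁₂,
      integral_add hi₁ hi₂, setIntegral_indicator measurableSet_Ioc,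
      setIntegral_indicator measurableSet_Ioc, hsub₁, hsub₂]
    have e1 : ∫ t in Ioc 0 T, d₁ t = -(1 / N) * J := by
      rw [hd₁, integral_const_mul, hJ, intervalIntegral.integral_of_le hT]
    have e2 : ∫ t in Ioc T (T + 1), d₂ t = Real.exp (-ρ * (T + 1)) *
        (I * (2 / M - ((∫ t in T..(T + 1), u t) + I) / M ^ 2)) := by
      have h1 : ∫ t in Ioc T (T + 1), (u t + I) / M ^ 2 =
          ((∫ t in T..(T + 1), u t) + I) / M ^ 2 := by
        rw [integral_div, integral_add hui (integrable_const I),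
          intervalIntegral.integral_of_le hT1]
        simp
      rw [hd₂, integral_const_mul, integral_const_mul, integral_sub (integrable_const _) hdiv, h1]
      simp
    rw [e1, e2]
    have e3 : 1 / M ≤ 2 / M - ((∫ t in T..(T + 1), u t) + I) / M ^ 2 := by
      have : ((∫ t in T..(T + 1), u t) + I) / M ^ 2 ≤ M / M ^ 2 := by gcongr
      have h2 : M / M ^ 2 = 1 / M := by field_simp
      have h3 : 2 / M = 1 / M + 1 / M := by ring
      linarith
    have e4 : 1 / N * J ≤ Real.exp (-ρ * (T + 1)) * (I * (1 / M)) := by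
      have h1 : Real.exp (-ρ * (T + 1)) * (I * (1 / M)) =
          J / (M * Real.exp ((ρ + K) * (T + 1))) := by
        rw [eq_div_iff (by positivity), hI]
        have : Real.exp (-ρ * (T + 1)) * Real.exp (-(K * (T + 1))) *
            Real.exp ((ρ + K) * (T + 1)) = 1 := by
          rw [← Real.exp_add, ← Real.exp_add, Real.exp_eq_one_iff]; ring
        calc _ = J * (Real.exp (-ρ * (T + 1)) * Real.exp (-(K * (T + 1))) *
            Real.exp ((ρ + K) * (T + 1))) * (1 / M * M) := by ring
          _ = J := by rw [this, one_div_mul_cancel hM.ne']; ring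
      rw [h1, one_div_mul_eq_div]
      gcongr
    have e5 := mul_le_mul_of_nonneg_left (mul_le_mul_of_nonneg_left e3 hI0)
      (Real.exp_pos (-ρ * (T + 1))).le
    linarith
  · filter_upwards [admissible_ae_pos hu (s := Ioi 0) Ioi_subset_Ici_self,
      ae_restrict_mem measurableSet_Ioi] with t hut ht
    have ht0 : 0 ≤ t := le_of_lt ht
    have hsq : state F x₀ w t ^ 2 ≤ state F x₀ u t ^ 2 :=
      pow_le_pow_left₀ (state_nonneg hF hx₀ hwA ht0) (hstate t ht0) 2
    have hcost : Real.exp (-ρ * t) * (c * state F x₀ w t ^ 2) ≤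
        Real.exp (-ρ * t) * (c * state F x₀ u t ^ 2) := by gcongr
    have he := Real.exp_pos (-ρ * t)
    suffices h : (Ioc 0 T).indicator d₁ t + (Ioc T (T + 1)).indicator d₂ t ≤
        Real.exp (-ρ * t) * (Real.log (w t) - Real.log (u t)) by
      simp only [payoff]; linarith
    rcases le_or_gt t T with h | h
    · have h2 : t ∉ Ioc T (T + 1) := fun h' => not_lt.2 h h'.1
      rw [indicator_of_mem (show t ∈ Ioc 0 T from ⟨ht, h⟩), indicator_of_notMem h2, add_zero,
        hw1 t h]
      rcases le_total (u t) N with h3 | h3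
      · simp [hd₁, min_eq_left h3]
      · have h4 := Real.log_le_sub_one_of_pos (div_pos hut hN0)
        rw [Real.log_div hut.ne' hN0.ne'] at h4
        have h5 : Real.exp (-ρ * t) ≤ 1 := Real.exp_le_one_iff.2 (by nlinarith)
        have h6 : 0 ≤ u t / N - 1 := by
          rw [sub_nonneg, one_le_div hN0]; exact h3
        have h7 : d₁ t = -(u t / N - 1) := by
          simp only [hd₁, min_eq_right h3]; field_simp
        rw [h7, min_eq_right h3]
        nlinarith [mul_nonneg (sub_nonneg.2 h5) h6, mul_le_mul_of_nonneg_left h4 he.le]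
    · have h2 : t ∉ Ioc 0 T := fun h' => not_lt.2 h'.2 h
      rw [indicator_of_notMem h2, zero_add]
      rcases le_or_gt t (T + 1) with h' | h'
      · rw [indicator_of_mem (show t ∈ Ioc T (T + 1) from ⟨h, h'⟩), hw2 t h h']
        have hy : 0 < u t + I := by linarith
        have h4 := Real.log_le_sub_one_of_pos (div_pos hut hy)
        rw [Real.log_div hut.ne' hy.ne'] at h4
        have h5 : u t / (u t + I) - 1 = -(I * (1 / (u t + I))) := by field_simp; ring
        -- the convex function `1 / x` lies above its tangent at `M`
        have h6 : 2 / M - (u t + I) / M ^ 2 ≤ 1 / (u t + I) := by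
          rw [div_sub_div _ _ hM.ne' (by positivity), div_le_div_iff₀ (by positivity) hy]
          nlinarith [mul_nonneg hM.le (sq_nonneg (u t + I - M))]
        have h7 := mul_le_mul_of_nonneg_left h6 hI0
        have h8 : Real.exp (-ρ * (T + 1)) ≤ Real.exp (-ρ * t) :=
          Real.exp_le_exp.2 (by nlinarith)
        have h9 : 0 ≤ I * (1 / (u t + I)) := by positivity
        calc d₂ t ≤ Real.exp (-ρ * (T + 1)) * (I * (1 / (u t + I))) :=
              mul_le_mul_of_nonneg_left h7 (Real.exp_pos _).le
          _ ≤ Real.exp (-ρ * t) * (I * (1 / (u t + I))) := mul_le_mul_of_nonneg_right h8 h9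
          _ ≤ _ := mul_le_mul_of_nonneg_left (by linarith) he.le
      · rw [indicator_of_notMem (fun h'' => not_lt.2 h''.2 h'), hw3 t h']
        simp

/-- Raising a control to a small level `η` on `[0, T]` pays: the logarithmic gain per unit of added
mass is of order `1 / η`, while the quadratic cost per unit of added mass is bounded. -/
lemma exists_lower_truncation {F : ℝ → ℝ} (hF : IsLakeDrift F) {ρ c x₀ : ℝ} (hρ : 0 < ρ)
    (hc : 0 < c) (hx₀ : 0 ≤ x₀) {u : ℝ → ℝ} (hu : u ∈ Admissible)
    (hbot : ⊥ < objective F ρ c x₀ u) {T C η : ℝ} (hT : 0 ≤ T)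
    (hsqi : IntegrableOn (fun t => Real.exp (-ρ * t) * state F x₀ u t ^ 2) (Ioi 0))
    (hsq : ∫ t in Ioi 0, Real.exp (-ρ * t) * state F x₀ u t ^ 2 ≤ C)
    (hη : 0 < η) (hηT : η * T ≤ 1) (hηC : η * (c * (C + 2 / ρ)) ≤ Real.exp (-ρ * T)) :
    ∃ w ∈ Admissible, objective F ρ c x₀ u ≤ objective F ρ c x₀ w ∧
      ∀ᵐ t ∂(volume.restrict (Icc 0 T)), w t = max (u t) η := by
  have hmaxI : ∀ S, IntegrableOn (fun t => max (u t) η - u t) (Icc 0 S) := fun S =>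
    ((admissible_integrableOn_Icc hu S).sup (integrable_const η)).sub
      (admissible_integrableOn_Icc hu S)
  set D : ℝ := ∫ t in (0 : ℝ)..T, (max (u t) η - u t) with hD
  have hDi : IntervalIntegrable (fun t => max (u t) η - u t) volume 0 T :=
    (intervalIntegrable_iff_integrableOn_Icc_of_le hT).2 (hmaxI T)
  have hD0 : 0 ≤ D := intervalIntegral.integral_nonneg hT fun t _ => by simp
  have hD1 : D ≤ 1 := by
    have h1 : D ≤ ∫ t in (0 : ℝ)..T, η := by
      apply intervalIntegral.integral_mono_ae_restrict hT hDi intervalIntegrable_const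
      filter_upwards [admissible_ae_pos hu (s := Icc 0 T) Icc_subset_Ici_self] with t ht
      rcases le_total (u t) η with h | h
      · rw [max_eq_right h]; linarith
      · rw [max_eq_left h]; linarith
    simp only [intervalIntegral.integral_const, sub_zero, smul_eq_mul] at h1
    linarith
  set w : ℝ → ℝ := fun t => u t + (Iic T).indicator (fun t => max (u t) η - u t) t with hw
  have hw1 : ∀ t, t ≤ T → w t = max (u t) η := fun t ht => by simp [hw, ht, indicator_of_mem]
  have hw2 : ∀ t, T < t → w t = u t := fun t ht => by simp [hw, ht]
  have hwu : ∀ t, u t ≤ w t := fun t => by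
    rcases le_or_gt t T with h | h
    · rw [hw1 t h]; exact le_max_left _ _
    · rw [hw2 t h]
  have hwA : w ∈ Admissible := by
    refine admissible_iff.2 ⟨fun n => ?_, ?_⟩
    · exact (admissible_integrableOn_Icc hu n).add ((hmaxI n).indicator measurableSet_Iic)
    · filter_upwards [hu.2] with t ht using ht.trans_le (hwu t)
  have hstate : ∀ t, 0 ≤ t → state F x₀ w t ≤ state F x₀ u t + D ∧
      state F x₀ u t ≤ state F x₀ w t := by
    intro t ht
    obtain ⟨h1, h2⟩ := state_mono hF hx₀ hwA hu ht (Eventually.of_forall hwu)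
    refine ⟨?_, h1⟩
    have h3 : ∫ s in (0 : ℝ)..t, (w s - u s) ≤ D := by
      have hwi : ∀ a b, 0 ≤ a → 0 ≤ b → IntervalIntegrable (fun s => w s - u s) volume a b :=
        fun a b ha hb => (admissible_intervalIntegrable hwA ha hb).sub
          (admissible_intervalIntegrable hu ha hb)
      have h4 : ∫ s in (0 : ℝ)..T, (w s - u s) = D := by
        refine intervalIntegral.integral_congr fun s hs => ?_
        rw [uIcc_of_le hT] at hs
        simp only [hw1 s hs.2]
      rcases le_total t T with h | h
      · rw [← h4, ← intervalIntegral.integral_add_adjacent_intervals (hwi 0 t le_rfl ht)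
          (hwi t T ht hT)]
        have := intervalIntegral.integral_nonneg (μ := volume) h fun s _ => sub_nonneg.2 (hwu s)
        linarith
      · rw [← intervalIntegral.integral_add_adjacent_intervals (hwi 0 T le_rfl hT)
          (hwi T t hT ht), h4, intervalIntegral.integral_of_le h,
          setIntegral_eq_zero_of_forall_eq_zero fun s hs => by rw [hw2 s hs.1, sub_self], add_zero]
    linarith
  refine ⟨w, hwA, ?_, ?_⟩
  swap
  · filter_upwards [ae_restrict_mem measurableSet_Icc] with t ht using hw1 t ht.2
  have hpi := integrableOn_payoff hF hρ hc hx₀ hu hbot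
  -- `d` bounds the logarithmic gain from below, and `-e` bounds the additional cost from above
  set d : ℝ → ℝ := fun t => Real.exp (-ρ * T) / η * (max (u t) η - u t) with hd
  set e : ℝ → ℝ := fun t => -(c * D) *
    (Real.exp (-ρ * t) * state F x₀ u t ^ 2 + 2 * Real.exp (-ρ * t)) with he
  have hdT : IntegrableOn d (Ioc 0 T) := ((hmaxI T).mono_set Ioc_subset_Icc_self).const_mul _
  have hdi : IntegrableOn ((Ioc 0 T).indicator d) (Ioi 0) :=
    (hdT.integrable_indicator measurableSet_Ioc).integrableOn
  have hexp : IntegrableOn (fun t => 2 * Real.exp (-ρ * t)) (Ioi 0) :=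
    (integrableOn_exp_mul_Ioi (neg_lt_zero.2 hρ) 0).const_mul 2
  have hei : IntegrableOn e (Ioi 0) := (hsqi.add hexp).const_mul _
  have hde : IntegrableOn (fun t => (Ioc 0 T).indicator d t + e t) (Ioi 0) := hdi.add hei
  have hle := integral_le_objective (g := fun t => payoff F ρ c x₀ u t +
    ((Ioc 0 T).indicator d t + e t)) hF hρ hc hx₀ hwA (hpi.add hde) ?_
  · refine le_trans ?_ hle
    rw [objective_eq_integral hpi, EReal.coe_le_coe_iff, integral_add hpi hde,
      integral_add hdi hei, setIntegral_indicator measurableSet_Ioc,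
      inter_eq_right.2 Ioc_subset_Ioi_self, hd, integral_const_mul,
      ← intervalIntegral.integral_of_le hT, ← hD, he, integral_const_mul,
      integral_add hsqi hexp, integral_const_mul, integral_exp_neg_mul_Ioi hρ]
    rw [mul_zero, Real.exp_zero]
    have h1 : c * (C + 2 / ρ) ≤ Real.exp (-ρ * T) / η := by
      rw [le_div_iff₀ hη]; linarith
    have h2 := mul_le_mul_of_nonneg_right h1 hD0
    have h3 := mul_le_mul_of_nonneg_left hsq (mul_nonneg hc.le hD0)
    have h4 : 2 / ρ = 2 * (1 / ρ) := by ring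
    rw [h4] at h2
    linarith
  · filter_upwards [admissible_ae_pos hu (s := Ioi 0) Ioi_subset_Ici_self,
      ae_restrict_mem measurableSet_Ioi] with t hut ht
    have ht0 : 0 ≤ t := le_of_lt ht
    have hexpt := Real.exp_pos (-ρ * t)
    have hxu := state_nonneg hF hx₀ hu ht0
    obtain ⟨hs1, hs2⟩ := hstate t ht0
    have hcost : state F x₀ w t ^ 2 - state F x₀ u t ^ 2 ≤ D * (state F x₀ u t ^ 2 + 2) := by
      have h1 : state F x₀ w t ^ 2 ≤ (state F x₀ u t + D) ^ 2 :=
        pow_le_pow_left₀ (hxu.trans hs2) hs1 2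
      nlinarith [mul_nonneg hD0 (sq_nonneg (state F x₀ u t - 1))]
    have hcost' := mul_le_mul_of_nonneg_left hcost (mul_nonneg hexpt.le hc.le)
    suffices h : (Ioc 0 T).indicator d t ≤
        Real.exp (-ρ * t) * (Real.log (w t) - Real.log (u t)) by
      simp only [payoff, he]; linarith
    rcases le_or_gt t T with h | h
    · rw [indicator_of_mem (show t ∈ Ioc 0 T from ⟨ht, h⟩), hw1 t h]
      rcases le_total (u t) η with h3 | h3
      · have h4 := Real.log_le_sub_one_of_pos (div_pos hut hη)
        rw [Real.log_div hut.ne' hη.ne'] at h4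
        have h5 : Real.exp (-ρ * T) ≤ Real.exp (-ρ * t) := Real.exp_le_exp.2 (by nlinarith)
        have h6 : 0 ≤ 1 - u t / η := by
          rw [sub_nonneg, div_le_one hη]; exact h3
        have h7 : d t = Real.exp (-ρ * T) * (1 - u t / η) := by
          simp only [hd, max_eq_right h3]; field_simp
        rw [h7, max_eq_right h3]
        exact mul_le_mul h5 (by linarith) h6 hexpt.le
      · simp [hd, max_eq_left h3]
    · rw [indicator_of_notMem (fun h' => not_lt.2 h'.2 h), hw2 t h]
      simp

/-- Both truncations together, with exponential bounds: the lower truncation is applied to the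
result of the upper one, which is again near-optimal. -/
lemma exists_isLocalizationPair {F : ℝ → ℝ} (hF : IsLakeDrift F) {ρ c x₀ : ℝ} (hρ : 0 < ρ)
    (hc : 0 < c) (hx₀ : 0 ≤ x₀) : ∃ N η : ℝ → ℝ, IsLocalizationPair F ρ c x₀ N η := by
  obtain ⟨K, hK, hLip⟩ := hF.exists_lipschitz
  obtain ⟨C, hC, hsq⟩ := exists_integral_sq_le hF hρ hc hx₀
  obtain ⟨A, a, hA, ha, hmass⟩ := exists_integral_control_le hF hρ hc hx₀
  set b := a + (ρ + K) with hb
  set B := A * Real.exp b + 1 with hB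
  have hb0 : 0 < b := by positivity
  have hB1 : 1 < B := by
    have : 0 < A * Real.exp b := by positivity
    linarith
  set h₀ := min (min ρ 1) (1 / (c * (C + 2 / ρ))) with hh₀
  have hh0 : 0 < h₀ := by positivity
  refine ⟨fun T => B * Real.exp (b * T), fun T => h₀ * Real.exp (-ρ * T),
    fun T _ => by positivity, by fun_prop, ?_, ?_, fun T _ => by positivity, by fun_prop, ?_, ?_, ?_⟩
  · intro s _ t _ hst
    exact mul_lt_mul_of_pos_left (Real.exp_lt_exp.2 (by nlinarith)) (by linarith)
  · have h1 := (tendsto_rpow_mul_exp_neg_mul_atTop_nhds_zero 1 ρ hρ).const_mul (Real.log B)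
    have h2 := (tendsto_rpow_mul_exp_neg_mul_atTop_nhds_zero 2 ρ hρ).const_mul b
    have h3 := h1.add h2
    simp only [mul_zero, add_zero] at h3
    refine h3.congr fun T => ?_
    rw [Real.log_mul (by linarith) (Real.exp_pos _).ne', Real.log_exp, Real.rpow_one,
      Real.rpow_two]
    ring
  · intro s _ t _ hst
    exact mul_lt_mul_of_pos_left (Real.exp_lt_exp.2 (by nlinarith)) hh0
  · intro T hT
    have h1 : h₀ ≤ 1 := (min_le_left _ _).trans (min_le_right _ _)
    have h2 : Real.exp (-ρ * T) ≤ 1 := Real.exp_le_one_iff.2 (by nlinarith)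
    have h3 : 1 ≤ Real.exp (b * T) := Real.one_le_exp (by positivity)
    have h4 := Real.exp_pos (-ρ * T)
    nlinarith
  · intro T hT1 u hu hlt
    have hT : 0 ≤ T := by linarith
    obtain ⟨w₁, hw₁, hle₁, heq₁⟩ := exists_upper_truncation hF hρ hc hx₀ hK hLip hu
      (bot_lt_objective hlt) hT (N := B * Real.exp (b * T)) (by positivity)
      (hmass u hu hlt (T + 1) (by linarith)) (by
        rw [mul_assoc, ← Real.exp_add, ← add_mul, ← hb, mul_add, mul_one, Real.exp_add]
        nlinarith [Real.exp_pos (b * T)])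
    have hlt₁ := hlt.trans_le hle₁
    obtain ⟨hsqi, hsqle⟩ := hsq w₁ hw₁ hlt₁
    obtain ⟨w₂, hw₂, hle₂, heq₂⟩ := exists_lower_truncation hF hρ hc hx₀ hw₁
      (bot_lt_objective hlt₁) hT hsqi hsqle (η := h₀ * Real.exp (-ρ * T)) (by positivity) (by
        have h1 : h₀ ≤ ρ := (min_le_left _ _).trans (min_le_left _ _)
        have h2 : ρ * T ≤ Real.exp (ρ * T) := by linarith [Real.add_one_le_exp (ρ * T)]
        have h3 : Real.exp (-ρ * T) * Real.exp (ρ * T) = 1 := by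
          rw [← Real.exp_add, Real.exp_eq_one_iff]; ring
        have h4 := Real.exp_pos (-ρ * T)
        calc h₀ * Real.exp (-ρ * T) * T ≤ ρ * Real.exp (-ρ * T) * T := by gcongr
          _ = Real.exp (-ρ * T) * (ρ * T) := by ring
          _ ≤ Real.exp (-ρ * T) * Real.exp (ρ * T) := by gcongr
          _ = 1 := h3) (by
        have h1 : h₀ ≤ 1 / (c * (C + 2 / ρ)) := min_le_right _ _
        have h2 : h₀ * (c * (C + 2 / ρ)) ≤ 1 := by
          rwa [le_div_iff₀ (by positivity)] at h1
        have h4 := Real.exp_pos (-ρ * T)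
        nlinarith)
    refine ⟨w₂, hw₂, hle₁.trans hle₂, ?_⟩
    filter_upwards [heq₁, heq₂] with t h1 h2
    rw [h2, h1]

/-! ### Weak compactness of locally bounded sequences -/

lemma exists_subseq_tendsto_inner {H : Type*} [NormedAddCommGroup H] [InnerProductSpace ℝ H]
    [CompleteSpace H] [TopologicalSpace.SeparableSpace H] {f : ℕ → H} {R : ℝ}
    (hf : ∀ n, ‖f n‖ ≤ R) : ∃ θ : ℕ → ℕ, StrictMono θ ∧ ∃ g : H, ∀ y : H,
      Tendsto (fun n => inner ℝ (f (θ n)) y) atTop (𝓝 (inner ℝ g y)) := by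
  obtain ⟨ℓ, -, θ, hθ, hlim⟩ := WeakDual.isSeqCompact_closedBall ℝ H (0 : StrongDual ℝ H) R
    (x := fun n => StrongDual.toWeakDual (InnerProductSpace.toDual ℝ H (f n))) (fun n => by
      simpa using hf n)
  refine ⟨θ, hθ, (InnerProductSpace.toDual ℝ H).symm (WeakDual.toStrongDual ℓ), fun y => ?_⟩
  have h := ((WeakDual.eval_continuous y).tendsto ℓ).comp hlim
  rw [InnerProductSpace.toDual_symm_apply]
  exact h

/-- A sequence of functions on `[0, ∞)` with uniform bounds on bounded intervals has a subsequence
that converges weakly in `L¹([0, T])` for every `T`. After division by the bound and multiplication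
with `e^{-t}` this is weak compactness of balls in `L²([0, ∞))`. -/
lemma exists_subseq_weakTendstoL1 {g : ℕ → ℝ → ℝ} {B : ℕ → ℝ}
    (hm : ∀ n, AEStronglyMeasurable (g n) (volume.restrict (Ici 0)))
    (hB : ∀ n k : ℕ, ∀ᵐ t ∂(volume.restrict (Icc (0 : ℝ) k)), |g n t| ≤ B k) :
    ∃ θ : ℕ → ℕ, StrictMono θ ∧ ∃ v : ℝ → ℝ, ∀ T, 0 < T →
      WeakTendstoL1 T (fun n => g (θ n)) v := by
  set b : ℝ → ℝ := fun t => 1 + ∑ j ∈ Finset.range (⌈t⌉₊ + 1), |B j| with hb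
  have hbmono : Monotone b := fun s t hst => by
    simp only [hb]
    gcongr
  have hb1 : ∀ t, 1 ≤ b t := fun t => by
    simp only [hb]
    linarith [Finset.sum_nonneg fun j (_ : j ∈ Finset.range (⌈t⌉₊ + 1)) => abs_nonneg (B j)]
  have hbpos : ∀ t, 0 < b t := fun t => zero_lt_one.trans_le (hb1 t)
  have hbm : Measurable b := hbmono.measurable
  have hgb : ∀ n, ∀ᵐ t ∂(volume.restrict (Ici (0 : ℝ))), |g n t| ≤ b t := by
    intro n
    rw [ae_restrict_iff' measurableSet_Ici]
    have h1 : ∀ᵐ t : ℝ, ∀ k : ℕ, t ∈ Icc (0 : ℝ) k → |g n t| ≤ B k :=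
      ae_all_iff.2 fun k => (ae_restrict_iff' measurableSet_Icc).1 (hB n k)
    filter_upwards [h1] with t ht ht0
    refine (ht ⌈t⌉₊ ⟨ht0, Nat.le_ceil t⟩).trans ?_
    have h2 := Finset.single_le_sum (f := fun j => |B j|) (fun j _ => abs_nonneg (B j))
      (Finset.self_mem_range_succ ⌈t⌉₊)
    simp only [hb]
    linarith [le_abs_self (B ⌈t⌉₊)]
  set μ := volume.restrict (Ici (0 : ℝ)) with hμ
  have hexp : MemLp (fun t : ℝ => Real.exp (-t)) 2 μ := by
    rw [memLp_two_iff_integrable_sq (by fun_prop)]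
    have h1 := integrableOn_exp_mul_Ioi (a := -2) (by norm_num) 0
    rw [hμ, ← restrict_Ioi_eq_restrict_Ici]
    refine h1.congr (Eventually.of_forall fun t => ?_)
    simp only [← Real.exp_nat_mul]
    congr 1; push_cast; ring
  set h : ℕ → ℝ → ℝ := fun n t => Real.exp (-t) * (g n t / b t) with hh
  have hhm : ∀ n, AEStronglyMeasurable (h n) μ := fun n =>
    ((by fun_prop : Measurable fun t : ℝ => Real.exp (-t)).aemeasurable.mul
      ((hm n).aemeasurable.div hbm.aemeasurable)).aestronglyMeasurable
  have hhb : ∀ n, ∀ᵐ t ∂μ, ‖h n t‖ ≤ ‖Real.exp (-t)‖ := by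
    intro n
    filter_upwards [hgb n] with t ht
    rw [hh, norm_mul, norm_div, Real.norm_eq_abs (g n t), Real.norm_of_nonneg (hbpos t).le]
    exact mul_le_of_le_one_right (norm_nonneg _) ((div_le_one (hbpos t)).2 ht)
  have hhL : ∀ n, MemLp (h n) 2 μ := fun n => hexp.mono (hhm n) (hhb n)
  have : Fact ((2 : ENNReal) ≠ ⊤) := ⟨by simp⟩
  obtain ⟨θ, hθ, G, hG⟩ := exists_subseq_tendsto_inner (f := fun n => (hhL n).toLp)
    (R := ‖hexp.toLp‖) fun n => by
      refine Lp.norm_le_norm_of_ae_le ?_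
      filter_upwards [(hhL n).coeFn_toLp, hexp.coeFn_toLp, hhb n] with t h1 h2 h3
      rwa [h1, h2]
  refine ⟨θ, hθ, fun t => Real.exp t * b t * G t, fun T hT => ?_⟩
  have hsub : Icc 0 T ⊆ Ici (0 : ℝ) := Icc_subset_Ici_self
  have hμT : μ.restrict (Icc 0 T) = volume.restrict (Icc 0 T) := by
    rw [hμ, Measure.restrict_restrict measurableSet_Icc, inter_eq_left.2 hsub]
  have hEb : ∀ t ∈ Icc 0 T, ‖Real.exp t * b t‖ ≤ Real.exp T * b T := by
    intro t ht
    rw [Real.norm_of_nonneg (by have := hbpos t; positivity)]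
    exact mul_le_mul (Real.exp_le_exp.2 ht.2) (hbmono ht.2) (hbpos t).le (Real.exp_pos _).le
  have hEbm : Measurable fun t => Real.exp t * b t := Real.measurable_exp.mul hbm
  refine ⟨Eventually.of_forall fun n => ?_, ?_, fun φ hφ => ?_⟩
  · refine Integrable.of_bound (C := b T) ?_ ?_
    · exact (hm _).mono_measure (Measure.restrict_mono hsub le_rfl)
    · filter_upwards [ae_restrict_of_ae_restrict_of_subset hsub (hgb (θ n)),
        ae_restrict_mem measurableSet_Icc] with t h1 h2
      exact h1.trans (hbmono h2.2)
  · have h1 : IntegrableOn G (Icc 0 T) := by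
      have h2 : MemLp G 2 (volume.restrict (Icc 0 T)) := hμT ▸ (Lp.memLp G).restrict _
      exact h2.integrable (by norm_num)
    refine Integrable.bdd_mul (c := Real.exp T * b T) h1 hEbm.aestronglyMeasurable ?_
    filter_upwards [ae_restrict_mem measurableSet_Icc] with t ht using hEb t ht
  · set ψ : ℝ → ℝ := (Icc 0 T).indicator fun t => Real.exp t * b t * φ t with hψ
    have hψL : MemLp ψ 2 μ := by
      rw [hψ, memLp_indicator_iff_restrict measurableSet_Icc, hμT]
      have h1 : MemLp (fun t => Real.exp t * b t) ⊤ (volume.restrict (Icc 0 T)) := by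
        refine MemLp.of_bound hEbm.aestronglyMeasurable (Real.exp T * b T) ?_
        filter_upwards [ae_restrict_mem measurableSet_Icc] with t ht using hEb t ht
      have h2 : MemLp (fun t => Real.exp t * b t * φ t) ⊤ (volume.restrict (Icc 0 T)) :=
        hφ.mul h1
      exact h2.mono_exponent le_top
    have key : ∀ (p q : ℝ → ℝ) (P : Lp ℝ 2 μ), (∀ᵐ t ∂μ, P t = p t) →
        (∀ t, p t * (Real.exp t * b t) = q t) →
        inner ℝ P hψL.toLp = ∫ t in Icc 0 T, q t * φ t := by
      intro p q P hP hpq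
      rw [L2.inner_def, ← hμT, ← integral_indicator measurableSet_Icc]
      refine integral_congr_ae ?_
      filter_upwards [hP, hψL.coeFn_toLp] with t h1 h2
      rw [h1, h2, hψ]
      by_cases ht : t ∈ Icc 0 T
      · simp only [indicator_of_mem ht, ← hpq]
        simp only [RCLike.inner_apply, conj_trivial]
        ring
      · simp [indicator_of_notMem ht]
    have h1 := hG hψL.toLp
    rw [key (fun t => G t) (fun t => Real.exp t * b t * G t) G
      (Eventually.of_forall fun _ => rfl) (fun t => by ring)] at h1
    refine h1.congr fun n => ?_
    refine key (h (θ n)) (g (θ n)) _ (hhL (θ n)).coeFn_toLp fun t => ?_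
    have := (hbpos t).ne'
    simp only [hh]
    rw [Real.exp_neg]
    field_simp

lemma WeakTendstoL1.congr {T : ℝ} {f f' : ℕ → ℝ → ℝ} {g : ℝ → ℝ} (h : WeakTendstoL1 T f g)
    (hff' : ∀ᶠ n in atTop, f n =ᵐ[volume.restrict (Icc 0 T)] f' n) : WeakTendstoL1 T f' g := by
  obtain ⟨h1, h2, h3⟩ := h
  refine ⟨?_, h2, fun φ hφ => (h3 φ hφ).congr' ?_⟩
  · filter_upwards [h1, hff'] with n h4 h5 using h4.congr h5
  · filter_upwards [hff'] with n h5
    refine integral_congr_ae ?_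
    filter_upwards [h5] with t ht
    rw [ht]

lemma WeakTendstoL1.comp {T : ℝ} {f : ℕ → ℝ → ℝ} {g : ℝ → ℝ} (h : WeakTendstoL1 T f g)
    {θ : ℕ → ℕ} (hθ : Tendsto θ atTop atTop) : WeakTendstoL1 T (fun n => f (θ n)) g :=
  ⟨hθ.eventually h.1, h.2.1, fun φ hφ => (h.2.2 φ hφ).comp hθ⟩

/-! ### The diagonal procedures -/

section Diagonal

variable {F : ℝ → ℝ} {ρ c x₀ : ℝ} {N η : ℝ → ℝ}

lemma IsLocalizationPair.truncation_mem (hP : IsLocalizationPair F ρ c x₀ N η) {T : ℝ}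
    (hT : 0 < T) (y : ℝ) :
    η T ≤ max (min y (N T)) (η T) ∧ max (min y (N T)) (η T) ≤ N T :=
  ⟨le_max_right _ _, max_le (min_le_right _ _) (hP.lower_lt_upper T hT).le⟩

lemma IsLocalizationPair.bounds_mono (hP : IsLocalizationPair F ρ c x₀ N η) {S T y : ℝ}
    (hS : 0 ≤ S) (hST : S ≤ T) (h : η S ≤ y ∧ y ≤ N S) : η T ≤ y ∧ y ≤ N T :=
  ⟨(hP.lower_anti.antitoneOn hS (hS.trans hST) hST).trans h.1,
    h.2.trans (hP.upper_mono.monotoneOn hS (hS.trans hST) hST)⟩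

/-- Once localized on `[0, T + 1]`, a control is not changed on that interval by the later steps:
it already takes its values between the wider bounds. The relation `r` keeps track of the index. -/
lemma IsLocalizationPair.exists_ae_eq (hP : IsLocalizationPair F ρ c x₀ N η)
    {w ubar : ℕ → ℕ → ℝ → ℝ} {σ : ℕ → ℕ → ℕ}
    (htrunc : ∀ (T n : ℕ), ∀ᵐ t ∂(volume.restrict (Icc (0 : ℝ) (T + 1))),
      w (T + 1) n t = max (min (ubar T n t) (N (T + 1))) (η (T + 1)))
    (hext : ∀ T n, ubar (T + 1) n = w (T + 1) (σ (T + 1) n))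
    {r : ℕ → ℕ → Prop} (hrefl : ∀ n, r n n) (htrans : ∀ a b d, r a b → r b d → r a d)
    (hσ : ∀ T n, r n (σ (T + 1) n)) (T k n : ℕ) :
    ∃ m, r n m ∧ ∀ᵐ t ∂(volume.restrict (Icc (0 : ℝ) (T + 1))),
      ubar (T + 1 + k) n t = ubar (T + 1) m t ∧
        η (T + 1) ≤ ubar (T + 1) m t ∧ ubar (T + 1) m t ≤ N (T + 1) := by
  induction k generalizing n with
  | zero =>
    refine ⟨n, hrefl n, ?_⟩
    filter_upwards [htrunc T (σ (T + 1) n)] with t ht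
    rw [add_zero]
    refine ⟨rfl, ?_⟩
    rw [hext, ht]
    exact hP.truncation_mem (by positivity) _
  | succ k ih =>
    obtain ⟨m, hm, hae⟩ := ih (σ (T + 1 + k + 1) n)
    refine ⟨m, htrans _ _ _ (hσ _ n) hm, ?_⟩
    have hsub : Icc (0 : ℝ) (T + 1) ⊆ Icc (0 : ℝ) ((T + 1 + k : ℕ) + 1) :=
      Icc_subset_Icc_right (by push_cast; linarith [(k.cast_nonneg : (0 : ℝ) ≤ k)])
    filter_upwards [hae, ae_restrict_of_ae_restrict_of_subset hsub
      (htrunc (T + 1 + k) (σ (T + 1 + k + 1) n))] with t h1 h2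
    refine ⟨?_, h1.2⟩
    have h3 := hP.bounds_mono (T := (T + 1 + k : ℕ) + 1) (by positivity)
      (by push_cast; linarith [(k.cast_nonneg : (0 : ℝ) ≤ k)]) h1.2
    rw [← add_assoc, hext, h2, h1.1, min_eq_left h3.2, max_eq_left h3.1]

/-- Localizing every control on `[0, 1]`, `[0, 2]`, … produces for each index one locally bounded
function `g n` on `[0, ∞)`, as the values on a bounded interval do not change after finitely many
steps. A single weakly convergent subsequence of `g` serves all intervals. -/
lemma exists_isFirstDiagonal (hP : IsLocalizationPair F ρ c x₀ N η) {u : ℕ → ℝ → ℝ}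
    (hu : IsMaximizing F ρ c x₀ u)
    (hlt : ∀ n, value F ρ c x₀ - 1 < objective F ρ c x₀ (u n)) :
    ∃ (w ubar : ℕ → ℕ → ℝ → ℝ) (σ : ℕ → ℕ → ℕ) (v : ℝ → ℝ),
      IsFirstDiagonal F ρ c x₀ N η u w ubar σ v := by
  have hstep : ∀ (T : ℕ) (y : {y : ℝ → ℝ // y ∈ Admissible ∧
      value F ρ c x₀ - 1 < objective F ρ c x₀ y}),
      ∃ y' : {y : ℝ → ℝ // y ∈ Admissible ∧ value F ρ c x₀ - 1 < objective F ρ c x₀ y},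
        objective F ρ c x₀ y.1 ≤ objective F ρ c x₀ y'.1 ∧
        ∀ᵐ t ∂(volume.restrict (Icc (0 : ℝ) (T + 1))),
          y'.1 t = max (min (y.1 t) (N (T + 1))) (η (T + 1)) := by
    rintro T ⟨y, hy, hy'⟩
    obtain ⟨y', h1, h2, h3⟩ := hP.localize (T + 1)
      (by linarith [(T.cast_nonneg : (0 : ℝ) ≤ T)]) y hy hy'
    exact ⟨⟨y', h1, hy'.trans_le h2⟩, h2, h3⟩
  choose step hstep1 hstep2 using hstep
  -- localization without extraction of subsequences
  let Z : ℕ → ℕ → {y : ℝ → ℝ // y ∈ Admissible ∧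
      value F ρ c x₀ - 1 < objective F ρ c x₀ y} := fun T n =>
    Nat.rec ⟨u n, hu.1 n, hlt n⟩ (fun T y => step T y) T
  let z : ℕ → ℕ → ℝ → ℝ := fun T n => (Z T n).1
  have hz_trunc : ∀ (T n : ℕ), ∀ᵐ t ∂(volume.restrict (Icc (0 : ℝ) (T + 1))),
      z (T + 1) n t = max (min (z T n t) (N (T + 1))) (η (T + 1)) := fun T n =>
    hstep2 T (Z T n)
  have hz_better : ∀ T n, objective F ρ c x₀ (z T n) ≤ objective F ρ c x₀ (z (T + 1) n) :=
    fun T n => hstep1 T (Z T n)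
  have hz_eq : ∀ n, ∀ᵐ t : ℝ, ∀ T k : ℕ, t ∈ Icc (0 : ℝ) (T + 1) →
      z (T + 1 + k) n t = z (T + 1) n t ∧ η (T + 1) ≤ z (T + 1) n t ∧
        z (T + 1) n t ≤ N (T + 1) := by
    intro n
    refine ae_all_iff.2 fun T => ae_all_iff.2 fun k => ?_
    rw [← ae_restrict_iff' measurableSet_Icc]
    obtain ⟨m, rfl, hm⟩ := hP.exists_ae_eq (w := z) (σ := fun _ n => n) hz_trunc
      (fun _ _ => rfl) (r := Eq) (fun _ => rfl) (fun _ _ _ => Eq.trans) (fun _ _ => rfl) T k n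
    exact hm
  -- the final value at `t` is reached in step `⌈t⌉₊`
  let g : ℕ → ℝ → ℝ := fun n t => z ⌈t⌉₊ n t
  have hg : ∀ n, ∀ᵐ t : ℝ, ∀ T : ℕ, t ∈ Icc (0 : ℝ) (T + 1) →
      g n t = z (T + 1) n t ∧ |g n t| ≤ N (T + 1) := by
    intro n
    have h0 : ∀ᵐ t : ℝ, t ≠ 0 := by simp [ae_iff, measure_singleton]
    filter_upwards [hz_eq n, h0] with t ht ht0 T hT
    have hpos : 0 < ⌈t⌉₊ := Nat.ceil_pos.2 (lt_of_le_of_ne hT.1 ht0.symm)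
    obtain ⟨j, hj⟩ : ∃ j, ⌈t⌉₊ = j + 1 := ⟨⌈t⌉₊ - 1, by omega⟩
    have hjT : j + 1 ≤ T + 1 := hj ▸ Nat.ceil_le.2 (by exact_mod_cast hT.2)
    have htj : t ∈ Icc (0 : ℝ) (j + 1) := ⟨hT.1, by
      have := Nat.le_ceil t
      rw [hj] at this
      exact_mod_cast this⟩
    obtain ⟨k, hk⟩ := Nat.exists_eq_add_of_le hjT
    have h1 := (ht j k htj).1
    rw [← hk] at h1
    have h2 : g n t = z (T + 1) n t := by
      rw [h1]
      change z ⌈t⌉₊ n t = _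
      rw [hj]
    refine ⟨h2, ?_⟩
    have h3 := (ht T 0 hT).2
    rw [h2, abs_of_nonneg ((hP.lower_pos _ (by positivity)).le.trans h3.1)]
    exact h3.2
  have hg' : ∀ n T : ℕ, g n =ᵐ[volume.restrict (Icc (0 : ℝ) (T + 1))] z (T + 1) n := by
    intro n T
    refine (ae_restrict_iff' measurableSet_Icc).2 ?_
    filter_upwards [hg n] with t ht hT using (ht T hT).1
  have hgm : ∀ n, AEStronglyMeasurable (g n) (volume.restrict (Ici 0)) := by
    intro n
    refine LocallyIntegrableOn.aestronglyMeasurable ?_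
    refine locallyIntegrableOn_Ici_of_nat fun k => ?_
    have h1 : IntegrableOn (g n) (Icc 0 ((k : ℝ) + 1)) :=
      IntegrableOn.congr_fun_ae (admissible_integrableOn_Icc (Z (k + 1) n).2.1 _) (hg' n k).symm
    exact h1.mono_set (Icc_subset_Icc_right (by linarith))
  obtain ⟨θ, hθ, v, hv⟩ := exists_subseq_weakTendstoL1 (B := fun k => N (k + 1)) hgm fun n k => by
    refine (ae_restrict_iff' measurableSet_Icc).2 ?_
    filter_upwards [hg n] with t ht hT using (ht k ⟨hT.1, by linarith [hT.2]⟩).2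
  -- the single extraction is made in the first step
  refine ⟨fun T n => if T ≤ 1 then z T n else z T (θ n),
    fun T n => if T = 0 then u n else z T (θ n),
    fun T n => if T = 1 then θ n else n, v, hu, fun n => rfl, fun T n => ?_, fun T n => ?_,
    fun T n => ?_, fun T => ?_, fun T n => ?_, fun T => ?_⟩
  · split_ifs
    · exact (Z (T + 1) n).2.1
    · exact (Z (T + 1) (θ n)).2.1
  · rcases T with _ | T
    · exact hz_better 0 n
    · simpa using hz_better (T + 1) (θ n)
  · rcases T with _ | T
    · exact hz_trunc 0 n
    · simpa using hz_trunc (T + 1) (θ n)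
  · rcases T with _ | T
    · simpa using hθ
    · simpa using! strictMono_id
  · rcases T with _ | T <;> simp
  · refine (hv (T + 1) (by positivity)).congr (Eventually.of_forall fun n => ?_)
    simpa using hg' (θ n) T

variable {u : ℕ → ℝ → ℝ} {w ubar : ℕ → ℕ → ℝ → ℝ} {σ : ℕ → ℕ → ℕ} {v : ℝ → ℝ}

lemma IsFirstDiagonal.exists_objective_le (h : IsFirstDiagonal F ρ c x₀ N η u w ubar σ v)
    (T n : ℕ) : ubar T n ∈ Admissible ∧
      ∃ k, n ≤ k ∧ objective F ρ c x₀ (u k) ≤ objective F ρ c x₀ (ubar T n) := by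
  induction T generalizing n with
  | zero => rw [h.start]; exact ⟨h.maximizing.1 n, n, le_rfl, le_rfl⟩
  | succ T ih =>
    rw [h.extracted]
    obtain ⟨-, k, hk, hle⟩ := ih (σ (T + 1) n)
    exact ⟨h.admissible _ _, k, ((h.strictMono T).le_apply).trans hk, hle.trans (h.better _ _)⟩

lemma IsFirstDiagonal.tendsto_objective (h : IsFirstDiagonal F ρ c x₀ N η u w ubar σ v) :
    Tendsto (fun n => objective F ρ c x₀ (ubar n n)) atTop (𝓝 (value F ρ c x₀)) := by
  choose k hk hle using fun n => (h.exists_objective_le n n).2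
  exact tendsto_of_tendsto_of_tendsto_of_le_of_le
    (h.maximizing.2.comp (tendsto_atTop_mono hk tendsto_id)) tendsto_const_nhds hle
    fun n => objective_le_value (h.exists_objective_le n n).1

/-- On `[0, T + 1]`, the diagonal sequence is from some index on a subsequence of the sequence
obtained in step `T + 1`. -/
lemma IsFirstDiagonal.exists_diagonal_ae_eq (hP : IsLocalizationPair F ρ c x₀ N η)
    (h : IsFirstDiagonal F ρ c x₀ N η u w ubar σ v) {T n : ℕ} (hTn : T + 1 ≤ n) :
    ∃ m, n ≤ m ∧ ∀ᵐ t ∂(volume.restrict (Icc (0 : ℝ) (T + 1))),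
      ubar n n t = ubar (T + 1) m t ∧ η (T + 1) ≤ ubar n n t ∧ ubar n n t ≤ N (T + 1) := by
  obtain ⟨k, rfl⟩ := Nat.exists_eq_add_of_le hTn
  obtain ⟨m, hm, hae⟩ := hP.exists_ae_eq h.truncated h.extracted (r := (· ≤ ·)) (fun _ => le_rfl)
    (fun _ _ _ => le_trans) (fun T n => (h.strictMono T).le_apply) T k (T + 1 + k)
  refine ⟨m, hm, ?_⟩
  filter_upwards [hae] with t ht
  rw [ht.1]
  exact ⟨rfl, ht.2⟩

lemma IsFirstDiagonal.weakTendstoL1_diagonal (hP : IsLocalizationPair F ρ c x₀ N η)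
    (h : IsFirstDiagonal F ρ c x₀ N η u w ubar σ v) (T : ℕ) :
    WeakTendstoL1 (T + 1) (fun n => ubar n n) v := by
  have hex : ∀ n, ∃ m, T + 1 ≤ n → n ≤ m ∧ ubar (T + 1) m
      =ᵐ[volume.restrict (Icc (0 : ℝ) (T + 1))] ubar n n := by
    intro n
    by_cases hn : T + 1 ≤ n
    · obtain ⟨m, hm, hae⟩ := h.exists_diagonal_ae_eq hP hn
      exact ⟨m, fun _ => ⟨hm, hae.mono fun t ht => ht.1.symm⟩⟩
    · exact ⟨0, fun h => absurd h hn⟩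
  choose m hm using hex
  refine ((h.weak T).comp (θ := m) ?_).congr ?_
  · refine tendsto_atTop_mono' atTop ?_ tendsto_id
    filter_upwards [eventually_ge_atTop (T + 1)] with n hn using (hm n hn).1
  · filter_upwards [eventually_ge_atTop (T + 1)] with n hn using (hm n hn).2

lemma exists_isSecondDiagonal (hP : IsLocalizationPair F ρ c x₀ N η)
    (h : IsFirstDiagonal F ρ c x₀ N η u w ubar σ v) :
    ∃ (τ : ℕ → ℕ) (f : ℝ → ℝ), IsSecondDiagonal (fun n => ubar n n) τ f := by
  set L : ℕ → ℝ := fun j => max |Real.log (η j)| |Real.log (N j)| with hL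
  have hL0 : ∀ j, 0 ≤ L j := fun j => (abs_nonneg _).trans (le_max_left _ _)
  -- cut off where the bounds are not yet in force
  set g : ℕ → ℝ → ℝ := fun n => (Icc (0 : ℝ) n).indicator fun t => Real.log (ubar n n t) with hg
  have hgm : ∀ n, AEStronglyMeasurable (g n) (volume.restrict (Ici 0)) := by
    intro n
    have h1 := (h.exists_objective_le n n).1.1.aestronglyMeasurable.aemeasurable
    exact (h1.log.indicator measurableSet_Icc).aestronglyMeasurable
  have hgB : ∀ n k : ℕ, ∀ᵐ t ∂(volume.restrict (Icc (0 : ℝ) k)),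
      |g n t| ≤ ∑ j ∈ Finset.range (k + 1), L j := by
    intro n k
    have h0 : ∀ᵐ t : ℝ, t ≠ 0 := by simp [ae_iff, measure_singleton]
    have h1 : ∀ᵐ t : ℝ, ∀ T : ℕ, T + 1 ≤ n → t ∈ Icc (0 : ℝ) (T + 1) →
        η (T + 1) ≤ ubar n n t ∧ ubar n n t ≤ N (T + 1) := by
      refine ae_all_iff.2 fun T => ?_
      by_cases hn : T + 1 ≤ n
      · obtain ⟨m, -, hae⟩ := h.exists_diagonal_ae_eq hP hn
        filter_upwards [(ae_restrict_iff' measurableSet_Icc).1 hae] with t ht _ htT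
          using (ht htT).2
      · exact Eventually.of_forall fun t h => absurd h hn
    refine (ae_restrict_iff' measurableSet_Icc).2 ?_
    filter_upwards [h0, h1] with t ht0 ht htk
    by_cases htn : t ∈ Icc (0 : ℝ) n
    · have htpos : 0 < t := lt_of_le_of_ne htk.1 ht0.symm
      have hn : (0 : ℝ) < n := htpos.trans_le htn.2
      have hk : (0 : ℝ) < k := htpos.trans_le htk.2
      rw [Nat.cast_pos] at hn hk
      obtain ⟨j, hj⟩ : ∃ j, min n k = j + 1 := ⟨min n k - 1, by omega⟩
      have hjt : t ∈ Icc (0 : ℝ) (j + 1) := ⟨htk.1, by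
        have h2 : t ≤ ((min n k : ℕ) : ℝ) := by
          rw [Nat.cast_min]; exact le_min htn.2 htk.2
        rw [hj] at h2
        exact_mod_cast h2⟩
      have h2 := ht j (by omega) hjt
      have hη : 0 < η (j + 1) := hP.lower_pos _ (by positivity)
      simp only [hg, indicator_of_mem htn]
      have h3 : |Real.log (ubar n n t)| ≤ L (j + 1) := by
        simp only [hL]
        push_cast
        exact abs_le_max_abs_abs (Real.log_le_log hη h2.1)
          (Real.log_le_log (hη.trans_le h2.1) h2.2)
      exact h3.trans (Finset.single_le_sum (f := L) (fun j _ => hL0 j)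
        (Finset.mem_range.2 (by omega)))
    · simp only [hg, indicator_of_notMem htn, abs_zero]
      exact Finset.sum_nonneg fun j _ => hL0 j
  obtain ⟨θ, hθ, f, hf⟩ := exists_subseq_weakTendstoL1 hgm hgB
  refine ⟨θ, f, hθ, fun T hT => (hf T hT).congr ?_⟩
  obtain ⟨k, hk⟩ := exists_nat_ge T
  filter_upwards [eventually_ge_atTop k] with n hn
  filter_upwards [ae_restrict_mem measurableSet_Icc] with t ht
  have hmem : t ∈ Icc (0 : ℝ) (θ n) := by
    refine ⟨ht.1, ht.2.trans (hk.trans ?_)⟩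
    exact_mod_cast hn.trans hθ.le_apply
  simp only [hg, indicator_of_mem hmem]

end Diagonal

/-! ### Weak limits -/

lemma WeakTendstoL1.mono {S T : ℝ} {f : ℕ → ℝ → ℝ} {g : ℝ → ℝ} (h : WeakTendstoL1 T f g)
    (hST : S ≤ T) : WeakTendstoL1 S f g := by
  have hsub : Icc 0 S ⊆ Icc 0 T := Icc_subset_Icc_right hST
  refine ⟨h.1.mono fun n hn => hn.mono_set hsub, h.2.1.mono_set hsub, fun φ hφ => ?_⟩
  have hφ' : MemLp ((Icc 0 S).indicator φ) ⊤ (volume.restrict (Icc 0 T)) := by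
    rw [memLp_indicator_iff_restrict measurableSet_Icc,
      Measure.restrict_restrict measurableSet_Icc, inter_eq_left.2 hsub]
    exact hφ
  have key : ∀ q : ℝ → ℝ, ∫ t in Icc 0 T, q t * (Icc 0 S).indicator φ t =
      ∫ t in Icc 0 S, q t * φ t := by
    intro q
    have h1 : (fun t => q t * (Icc 0 S).indicator φ t) =
        (Icc 0 S).indicator fun t => q t * φ t := by
      ext t
      by_cases ht : t ∈ Icc 0 S <;> simp [ht]
    rw [h1, setIntegral_indicator measurableSet_Icc, inter_eq_right.2 hsub]
  simpa only [key] using h.2.2 _ hφ'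

lemma weakTendstoL1_const {T : ℝ} {g : ℝ → ℝ} (hg : IntegrableOn g (Icc 0 T)) :
    WeakTendstoL1 T (fun _ => g) g :=
  ⟨Eventually.of_forall fun _ => hg, hg, fun _ _ => tendsto_const_nhds⟩

lemma integrableOn_mul_of_memLp_top {T : ℝ} {q φ : ℝ → ℝ} (hq : IntegrableOn q (Icc 0 T))
    (hφ : MemLp φ ⊤ (volume.restrict (Icc 0 T))) :
    IntegrableOn (fun t => q t * φ t) (Icc 0 T) :=
  memLp_one_iff_integrable.1 (hφ.mul (memLp_one_iff_integrable.2 hq))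

lemma WeakTendstoL1.mul_add {T : ℝ} {f : ℕ → ℝ → ℝ} {g p q : ℝ → ℝ} (h : WeakTendstoL1 T f g)
    (hq : MemLp q ⊤ (volume.restrict (Icc 0 T))) (hp : IntegrableOn p (Icc 0 T)) :
    WeakTendstoL1 T (fun n t => f n t * q t + p t) (fun t => g t * q t + p t) := by
  refine ⟨h.1.mono fun n hn => (integrableOn_mul_of_memLp_top hn hq).add hp,
    (integrableOn_mul_of_memLp_top h.2.1 hq).add hp, fun φ hφ => ?_⟩
  have hqφ : MemLp (fun t => q t * φ t) ⊤ (volume.restrict (Icc 0 T)) := hφ.mul hq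
  have key : ∀ r : ℝ → ℝ, IntegrableOn r (Icc 0 T) →
      ∫ t in Icc 0 T, (r t * q t + p t) * φ t =
        (∫ t in Icc 0 T, r t * (q t * φ t)) + ∫ t in Icc 0 T, p t * φ t := by
    intro r hr
    rw [← integral_add (integrableOn_mul_of_memLp_top hr hqφ)
      (integrableOn_mul_of_memLp_top hp hφ)]
    refine integral_congr_ae (Eventually.of_forall fun t => ?_)
    ring
  rw [key g h.2.1]
  refine ((h.2.2 _ hqφ).add_const _).congr' ?_
  filter_upwards [h.1] with n hn using (key _ hn).symm

lemma WeakTendstoL1.ae_le {T : ℝ} {f g : ℕ → ℝ → ℝ} {f' g' : ℝ → ℝ} (hf : WeakTendstoL1 T f f')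
    (hg : WeakTendstoL1 T g g')
    (hfg : ∀ᶠ n in atTop, ∀ᵐ t ∂(volume.restrict (Icc 0 T)), f n t ≤ g n t) :
    ∀ᵐ t ∂(volume.restrict (Icc 0 T)), f' t ≤ g' t := by
  refine ae_le_of_forall_setIntegral_le hf.2.1 hg.2.1 fun A hA _ => ?_
  have hφ : MemLp (A.indicator fun _ => (1 : ℝ)) ⊤ (volume.restrict (Icc 0 T)) :=
    memLp_top_of_bound ((measurable_const.indicator hA).aestronglyMeasurable) 1
      (Eventually.of_forall fun t => by
        by_cases ht : t ∈ A <;> simp [ht])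
  have key : ∀ q : ℝ → ℝ, ∫ t in Icc 0 T, q t * A.indicator (fun _ => (1 : ℝ)) t =
      ∫ t in A, q t ∂(volume.restrict (Icc 0 T)) := by
    intro q
    rw [← integral_indicator hA]
    refine integral_congr_ae (Eventually.of_forall fun t => ?_)
    by_cases ht : t ∈ A <;> simp [ht]
  have h1 := hf.2.2 _ hφ
  have h2 := hg.2.2 _ hφ
  simp only [key] at h1 h2
  refine le_of_tendsto_of_tendsto h1 h2 ?_
  filter_upwards [hfg, hf.1, hg.1] with n h3 h4 h5
  exact integral_mono_ae h4.integrableOn h5.integrableOn (ae_restrict_of_ae h3)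

lemma memLp_top_Icc {q : ℝ → ℝ} {T : ℝ} (hq : ContinuousOn q (Icc 0 T)) :
    MemLp q ⊤ (volume.restrict (Icc 0 T)) := by
  obtain ⟨C, hC⟩ := isCompact_Icc.exists_bound_of_continuousOn hq
  refine memLp_top_of_bound (hq.aestronglyMeasurable measurableSet_Icc) C ?_
  filter_upwards [ae_restrict_mem measurableSet_Icc] with t ht using hC t ht

lemma WeakTendstoL1.tendsto_intervalIntegral {T : ℝ} {f : ℕ → ℝ → ℝ} {g φ : ℝ → ℝ}
    (h : WeakTendstoL1 T f g) (hφ : Continuous φ) {s : ℝ} (hs : 0 ≤ s) (hsT : s ≤ T) :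
    Tendsto (fun n => ∫ t in (0 : ℝ)..s, f n t * φ t) atTop
      (𝓝 (∫ t in (0 : ℝ)..s, g t * φ t)) := by
  have h1 := (h.mono hsT).2.2 φ (memLp_top_Icc hφ.continuousOn)
  simpa only [intervalIntegral.integral_of_le hs, integral_Icc_eq_integral_Ioc] using h1

lemma ae_restrict_Ici_of_forall {p : ℝ → Prop}
    (h : ∀ T : ℝ, 0 < T → ∀ᵐ t ∂(volume.restrict (Icc 0 T)), p t) :
    ∀ᵐ t ∂(volume.restrict (Ici (0 : ℝ))), p t := by
  have h1 : ∀ᵐ t : ℝ, ∀ n : ℕ, t ∈ Icc (0 : ℝ) (n + 1) → p t :=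
    ae_all_iff.2 fun n => (ae_restrict_iff' measurableSet_Icc).1 (h (n + 1) (by positivity))
  refine (ae_restrict_iff' measurableSet_Ici).2 ?_
  filter_upwards [h1] with t ht ht0
  obtain ⟨n, hn⟩ := exists_nat_ge t
  exact ht n ⟨ht0, by linarith⟩

lemma admissible_of_forall_bounds {u : ℝ → ℝ} (hm : ∀ T, 0 < T → IntegrableOn u (Icc 0 T))
    (hu : ∀ T : ℝ, 0 < T → ∃ a : ℝ, 0 < a ∧ ∀ᵐ t ∂(volume.restrict (Icc 0 T)), a ≤ u t) :
    u ∈ Admissible := by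
  refine admissible_iff.2 ⟨fun n => ?_, ae_restrict_Ici_of_forall fun T hT => ?_⟩
  · exact (hm (n + 1) (by positivity)).mono_set (Icc_subset_Icc_right (by linarith))
  · obtain ⟨a, ha, h⟩ := hu T hT
    filter_upwards [h] with t ht using ha.trans_le ht

/-! ### Convergence of the states -/

/-- Weak convergence of locally bounded controls implies pointwise convergence of the states: the
primitives of the controls converge, and the state depends continuously on them. -/
lemma tendsto_state {F : ℝ → ℝ} (hF : IsLakeDrift F) {x₀ : ℝ} (hx₀ : 0 ≤ x₀) {y : ℕ → ℝ → ℝ}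
    {v : ℝ → ℝ} (hy : ∀ n, y n ∈ Admissible) (hv : v ∈ Admissible) {T b : ℝ}
    (hyb : ∀ᶠ n in atTop, ∀ᵐ t ∂(volume.restrict (Icc 0 T)), y n t ≤ b)
    (hvb : ∀ᵐ t ∂(volume.restrict (Icc 0 T)), v t ≤ b)
    (hweak : WeakTendstoL1 T y v) {t : ℝ} (ht : t ∈ Icc 0 T) :
    Tendsto (fun n => state F x₀ (y n) t) atTop (𝓝 (state F x₀ v t)) := by
  set Δ : ℕ → ℝ → ℝ := fun n s => (∫ r in (0 : ℝ)..s, y n r) - ∫ r in (0 : ℝ)..s, v r with hΔ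
  have hprim : ∀ u ∈ Admissible, ContinuousOn (fun s => ∫ r in (0 : ℝ)..s, u r) (Icc 0 t) := by
    intro u hu
    have := intervalIntegral.continuousOn_primitive_interval'
      (admissible_intervalIntegrable hu le_rfl ht.1) left_mem_uIcc
    rwa [uIcc_of_le ht.1] at this
  have hΔc : ∀ n, ContinuousOn (Δ n) (Icc 0 t) := fun n => (hprim _ (hy n)).sub (hprim _ hv)
  have hΔlim : ∀ s ∈ Icc 0 t, Tendsto (fun n => Δ n s) atTop (𝓝 0) := by
    intro s hs
    have h1 := hweak.tendsto_intervalIntegral (φ := fun _ => 1) continuous_const hs.1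
      (hs.2.trans ht.2)
    simp only [mul_one] at h1
    simpa using h1.sub_const (∫ r in (0 : ℝ)..s, v r)
  have hint : ∀ u ∈ Admissible, (∀ᵐ t ∂(volume.restrict (Icc 0 T)), u t ≤ b) →
      ∀ s ∈ Icc 0 t, 0 ≤ ∫ r in (0 : ℝ)..s, u r ∧ ∫ r in (0 : ℝ)..s, u r ≤ |b| * t := by
    intro u hu hub s hs
    constructor
    · apply intervalIntegral.integral_nonneg_of_ae_restrict hs.1
      filter_upwards [admissible_ae_pos hu (s := Icc 0 s) Icc_subset_Ici_self] with r hr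
        using hr.le
    · have h1 : ∫ r in (0 : ℝ)..s, u r ≤ ∫ r in (0 : ℝ)..s, |b| := by
        apply intervalIntegral.integral_mono_ae_restrict hs.1
          (admissible_intervalIntegrable hu le_rfl hs.1) intervalIntegrable_const
        filter_upwards [ae_restrict_of_ae_restrict_of_subset
          (Icc_subset_Icc_right (hs.2.trans ht.2)) hub] with r hr using hr.trans (le_abs_self b)
      rw [intervalIntegral.integral_const, sub_zero, smul_eq_mul] at h1
      nlinarith [abs_nonneg b, hs.2]
  have hΔb : ∀ᶠ n in atTop, ∀ s ∈ Icc 0 t, |Δ n s| ≤ |b| * t := by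
    filter_upwards [hyb] with n hn s hs
    have h1 := hint _ (hy n) hn s hs
    have h2 := hint _ hv hvb s hs
    rw [abs_le]
    constructor <;> simp only [hΔ] <;> linarith [h1.1, h1.2, h2.1, h2.2]
  have hΔint : Tendsto (fun n => ∫ s in (0 : ℝ)..t, |Δ n s|) atTop (𝓝 0) := by
    have h1 := intervalIntegral.tendsto_integral_filter_of_dominated_convergence
      (μ := volume) (a := 0) (b := t) (F := fun n s => |Δ n s|) (f := fun _ => (0 : ℝ))
      (l := atTop) (fun _ => |b| * t) ?_ ?_ intervalIntegrable_const ?_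
    · simpa using h1
    · refine Eventually.of_forall fun n => ?_
      rw [uIoc_of_le ht.1]
      exact ((hΔc n).abs.mono Ioc_subset_Icc_self).aestronglyMeasurable measurableSet_Ioc
    · filter_upwards [hΔb] with n hn
      refine Eventually.of_forall fun s hs => ?_
      rw [uIoc_of_le ht.1] at hs
      simpa using hn s (Ioc_subset_Icc_self hs)
    · refine Eventually.of_forall fun s hs => ?_
      rw [uIoc_of_le ht.1] at hs
      simpa using (hΔlim s (Ioc_subset_Icc_self hs)).abs
  set M := x₀ + 2 * (|b| * t) with hM
  have hbt : 0 ≤ |b| * t := mul_nonneg (abs_nonneg b) ht.1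
  obtain ⟨K, hK⟩ := hF.exists_lipschitz_Icc M
  have hxv := isTrajectory_state hF hx₀ hv
  -- `x_n - Δ n` is a trajectory of the control `v + F (x_n) - F (x_n - Δ n)`
  have hbound : ∀ᶠ n in atTop, |state F x₀ (y n) t - Δ n t - state F x₀ v t| ≤
      Real.exp (K * t) * K * ∫ s in (0 : ℝ)..t, |Δ n s| := by
    filter_upwards [hyb, hΔb] with n hn hΔn
    have hxn := isTrajectory_state hF hx₀ (hy n)
    set x := state F x₀ (y n) with hx
    have hxc : ContinuousOn x (Icc 0 t) := hxn.1.mono Icc_subset_Ici_self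
    have hxM : ∀ s ∈ Icc 0 t, x s ∈ Icc 0 (x₀ + |b| * t) := fun s hs =>
      ⟨state_nonneg hF hx₀ (hy n) hs.1, (state_le hF hx₀ (hy n) hs.1).trans
        (by linarith [(hint _ (hy n) hn s hs).2])⟩
    have hzM : ∀ s ∈ Icc 0 t, x s - Δ n s ∈ Icc (-M) M := fun s hs => by
      have h1 := hxM s hs
      have h2 := abs_le.1 (hΔn s hs)
      constructor <;> linarith [h1.1, h1.2, h2.1, h2.2]
    have hxM' : ∀ s ∈ Icc 0 t, x s ∈ Icc (-M) M := fun s hs => by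
      have h1 := hxM s hs
      constructor <;> linarith [h1.1, h1.2]
    have hvM : ∀ s ∈ Icc 0 t, state F x₀ v s ∈ Icc (-M) M := fun s hs => by
      have h1 := state_nonneg hF hx₀ hv hs.1
      have h2 := (state_le hF hx₀ hv hs.1)
      have h3 := (hint _ hv hvb s hs).2
      constructor <;> linarith
    have hFi : ∀ z : ℝ → ℝ, ContinuousOn z (Icc 0 t) → ∀ s ∈ Icc 0 t,
        IntervalIntegrable (fun r => F (z r)) volume 0 s := fun z hz s hs =>
      ContinuousOn.intervalIntegrable ((hF.continuous.comp_continuousOn hz).mono (by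
        rw [uIcc_of_le hs.1]; exact Icc_subset_Icc_right hs.2))
    have hzc : ContinuousOn (fun s => x s - Δ n s) (Icc 0 t) := hxc.sub (hΔc n)
    have htt : t ∈ Icc 0 t := ⟨ht.1, le_rfl⟩
    have hdi : ∀ s ∈ Icc 0 t, IntervalIntegrable
        (fun s => v s + (F (x s) - F (x s - Δ n s))) volume 0 s := fun s hs =>
      (admissible_intervalIntegrable hv le_rfl hs.1).add ((hFi x hxc s hs).sub (hFi _ hzc s hs))
    have hz : IsTrajectoryOn F x₀ (fun s => v s + (F (x s) - F (x s - Δ n s))) t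
        (fun s => x s - Δ n s) := by
      refine ⟨hzc, fun s hs => ?_⟩
      have h1 : ∫ r in (0 : ℝ)..s, (F (x r - Δ n r) + (v r + (F (x r) - F (x r - Δ n r)))) =
          ∫ r in (0 : ℝ)..s, (F (x r) + v r) :=
        intervalIntegral.integral_congr fun r _ => by ring
      rw [h1]
      change x s - Δ n s = _
      rw [hxn.2 s hs.1, intervalIntegral.integral_add (hFi x hxc s hs)
        (admissible_intervalIntegrable (hy n) le_rfl hs.1), intervalIntegral.integral_add
        (hFi x hxc s hs) (admissible_intervalIntegrable hv le_rfl hs.1)]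
      simp only [hΔ]
      ring
    obtain ⟨E, hEc, hE0, hE, heq⟩ := exists_weight (S := Icc (-M) M) hF.continuous hF.antitone
      K.2 (fun p hp q hq => hK.dist_le_mul p hp q hq) (hdi t htt)
      (admissible_intervalIntegrable hv le_rfl ht.1) hz (hxv.on t) hzM hvM
    have h2 := heq t htt
    simp only [sub_self, zero_add, add_sub_cancel_left] at h2
    have hEt := hE 0 t le_rfl ht.1 le_rfl
    rw [hE0, mul_one, sub_zero] at hEt
    have h3 : |∫ s in (0 : ℝ)..t, E s * (F (x s) - F (x s - Δ n s))| ≤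
        ∫ s in (0 : ℝ)..t, Real.exp (K * t) * K * |Δ n s| := by
      refine (intervalIntegral.abs_integral_le_integral_abs ht.1).trans ?_
      have hcE : ContinuousOn (fun s => E s * (F (x s) - F (x s - Δ n s))) (uIcc 0 t) := by
        rw [uIcc_of_le ht.1]
        exact hEc.mul ((hF.continuous.comp_continuousOn hxc).sub
          (hF.continuous.comp_continuousOn hzc))
      refine intervalIntegral.integral_mono_on ht.1 hcE.abs.intervalIntegrable
        (ContinuousOn.intervalIntegrable ?_) fun s hs => ?_
      · rw [uIcc_of_le ht.1]
        exact continuousOn_const.mul (hΔc n).abs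
      · have h4 := hK.dist_le_mul _ (hxM' s hs) _ (hzM s hs)
        simp only [Real.dist_eq, sub_sub_cancel] at h4
        have h5 := hE 0 s le_rfl hs.1 hs.2
        rw [hE0] at h5
        have h6 := (hE s t hs.1 hs.2 le_rfl).1
        rw [abs_mul, abs_of_nonneg (by linarith : 0 ≤ E s), mul_assoc]
        exact mul_le_mul (h6.trans hEt.2) h4 (abs_nonneg _) (Real.exp_pos _).le
    rw [← h2, abs_mul, abs_of_nonneg (by linarith : 0 ≤ E t),
      intervalIntegral.integral_const_mul] at h3
    refine le_trans ?_ h3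
    exact le_mul_of_one_le_left (abs_nonneg _) hEt.1
  have h1 : Tendsto (fun n => state F x₀ (y n) t - Δ n t - state F x₀ v t) atTop (𝓝 0) := by
    refine squeeze_zero_norm' hbound ?_
    simpa using hΔint.const_mul (Real.exp (K * t) * K)
  have h2 := (h1.add (hΔlim t ⟨ht.1, le_rfl⟩)).add_const (state F x₀ v t)
  simp only [add_zero, zero_add] at h2
  refine h2.congr fun n => ?_
  ring

/-! ### Optimality of the limit -/

/-- Let `y` be a maximizing sequence with `y ⇀ v` and `log y ⇀ f`. Since the logarithm is concave,
`e^f ≤ v`, so the state of `e^f` lies below that of `v`, which is the limit of the states of `y`.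
As the tails of the payoffs are uniformly small, `e^f` is optimal. -/
theorem isOptimal_exp_of_weakTendstoL1 {F : ℝ → ℝ} (hF : IsLakeDrift F) {ρ c x₀ : ℝ} (hρ : 0 < ρ)
    (hc : 0 < c) (hx₀ : 0 ≤ x₀) {y : ℕ → ℝ → ℝ} {v f : ℝ → ℝ} (hy : ∀ n, y n ∈ Admissible)
    (hobj : Tendsto (fun n => objective F ρ c x₀ (y n)) atTop (𝓝 (value F ρ c x₀)))
    (hbd : ∀ T : ℝ, 0 < T → ∃ a b : ℝ, 0 < a ∧
      ∀ᶠ n in atTop, ∀ᵐ t ∂(volume.restrict (Icc 0 T)), a ≤ y n t ∧ y n t ≤ b)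
    (hv : ∀ T : ℝ, 0 < T → WeakTendstoL1 T y v)
    (hf : ∀ T : ℝ, 0 < T → WeakTendstoL1 T (fun n t => Real.log (y n t)) f) :
    IsOptimal F ρ c x₀ (fun t => Real.exp (f t)) ∧
      LocallyEssBounded (fun t => Real.exp (f t)) := by
  -- bounds pass to the weak limits
  have hlim : ∀ T : ℝ, 0 < T → ∃ a b : ℝ, 0 < a ∧
      (∀ᶠ n in atTop, ∀ᵐ t ∂(volume.restrict (Icc 0 T)), y n t ≤ b) ∧
      ∀ᵐ t ∂(volume.restrict (Icc 0 T)), (a ≤ v t ∧ v t ≤ b) ∧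
        Real.log a ≤ f t ∧ f t ≤ Real.log b := by
    intro T hT
    obtain ⟨a, b, ha, hab⟩ := hbd T hT
    have hconst : ∀ r : ℝ, WeakTendstoL1 T (fun _ _ => r) (fun _ => r) := fun r =>
      weakTendstoL1_const (integrable_const r)
    refine ⟨a, b, ha, hab.mono fun n hn => hn.mono fun t ht => ht.2, ?_⟩
    filter_upwards [(hconst a).ae_le (hv T hT) (hab.mono fun n hn => hn.mono fun t ht => ht.1),
      (hv T hT).ae_le (hconst b) (hab.mono fun n hn => hn.mono fun t ht => ht.2),
      (hconst (Real.log a)).ae_le (hf T hT) (hab.mono fun n hn => hn.mono fun t ht =>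
        Real.log_le_log ha ht.1),
      (hf T hT).ae_le (hconst (Real.log b)) (hab.mono fun n hn => hn.mono fun t ht =>
        Real.log_le_log (ha.trans_le ht.1) ht.2)] with t h1 h2 h3 h4
    exact ⟨⟨h1, h2⟩, h3, h4⟩
  have hexpL : ∀ T : ℝ, 0 < T → ∀ s : ℝ,
      MemLp (fun t => Real.exp (s * f t)) ⊤ (volume.restrict (Icc 0 T)) := by
    intro T hT s
    obtain ⟨a, b, ha, -, h⟩ := hlim T hT
    refine memLp_top_of_bound (((hf T hT).2.1.aestronglyMeasurable.aemeasurable.const_mul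
      s).exp.aestronglyMeasurable)
      (Real.exp (|s| * max |Real.log a| |Real.log b|)) ?_
    filter_upwards [h] with t ht
    rw [Real.norm_eq_abs, Real.abs_exp]
    refine Real.exp_le_exp.2 ((le_abs_self _).trans ?_)
    rw [abs_mul]
    exact mul_le_mul_of_nonneg_left (abs_le_max_abs_abs ht.2.1 ht.2.2) (abs_nonneg s)
  have hbdd : LocallyEssBounded (fun t => Real.exp (f t)) := fun T hT => by
    simpa using hexpL T hT 1
  have hvA : v ∈ Admissible := admissible_of_forall_bounds (fun T hT => (hv T hT).2.1)
    fun T hT => by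
      obtain ⟨a, b, ha, -, h⟩ := hlim T hT
      exact ⟨a, ha, h.mono fun t ht => ht.1.1⟩
  have huA : (fun t => Real.exp (f t)) ∈ Admissible :=
    admissible_of_forall_bounds (fun T hT => (hbdd T hT).integrable le_top) fun T hT => by
      obtain ⟨a, b, ha, -, h⟩ := hlim T hT
      refine ⟨a, ha, ?_⟩
      filter_upwards [h] with t ht
      exact (Real.exp_log ha).symm.trans_le (Real.exp_le_exp.2 ht.2.1)
  -- concavity of the logarithm, in the form `log y ≤ f + y e^{-f} - 1`
  have huv : ∀ T : ℝ, 0 < T → ∀ᵐ t ∂(volume.restrict (Icc 0 T)), Real.exp (f t) ≤ v t := by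
    intro T hT
    obtain ⟨a, b, ha, hab⟩ := hbd T hT
    have h1 := (hv T hT).mul_add (hexpL T hT (-1))
      ((hf T hT).2.1.sub (integrable_const (1 : ℝ)))
    have h2 := (hf T hT).ae_le h1 (hab.mono fun n hn => hn.mono fun t ht => by
      have hyt : 0 < y n t := ha.trans_le ht.1
      have h3 := Real.log_le_sub_one_of_pos (mul_pos hyt (Real.exp_pos (-1 * f t)))
      rw [Real.log_mul hyt.ne' (Real.exp_pos _).ne', Real.log_exp] at h3
      simp only [Pi.sub_apply]
      linarith)
    filter_upwards [h2] with t ht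
    simp only [Pi.sub_apply] at ht
    have h3 : 1 ≤ v t * Real.exp (-1 * f t) := by linarith
    rw [neg_one_mul, Real.exp_neg, ← div_eq_mul_inv, le_div_iff₀ (Real.exp_pos _)] at h3
    linarith
  obtain ⟨V, hV⟩ := exists_value_eq hF hρ hc hx₀
  obtain ⟨C, hC, hG⟩ := exists_payoff_le hF hρ hc hx₀
  have hfi : ∀ T : ℝ, 0 < T → IntervalIntegrable f volume 0 T := fun T hT =>
    (intervalIntegrable_iff_integrableOn_Icc_of_le hT.le).2 (hf T hT).2.1
  have hcont : Continuous fun t => Real.exp (-ρ * t) := by fun_prop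
  have hcost : ∀ u ∈ Admissible, ∀ T : ℝ, 0 < T → IntervalIntegrable
      (fun t => Real.exp (-ρ * t) * (c * state F x₀ u t ^ 2)) volume 0 T := fun u hu T hT =>
    (intervalIntegrable_comp_state hF hx₀ hu (G := fun z => c * z ^ 2) (by fun_prop) le_rfl
      hT.le).continuousOn_mul hcont.continuousOn
  have hpayi : ∀ T : ℝ, 0 < T →
      IntervalIntegrable (payoff F ρ c x₀ (fun t => Real.exp (f t))) volume 0 T := by
    intro T hT
    refine (((hfi T hT).continuousOn_mul hcont.continuousOn).sub (hcost _ huA T hT)).congr_ae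
      (Eventually.of_forall fun t => ?_)
    simp only [payoff, Real.log_exp]
    ring
  -- the payoff of the limit on `[0, T]`, up to the tail of the payoffs, is at least the value
  have hmain : ∀ T : ℝ, 0 < T → V - C * Real.exp (-ρ * T) ≤
      ∫ t in (0 : ℝ)..T, payoff F ρ c x₀ (fun t => Real.exp (f t)) t := by
    intro T hT
    obtain ⟨a, b, ha, hyb, hab⟩ := hlim T hT
    have h1 := (hf T hT).tendsto_intervalIntegral hcont hT.le le_rfl
    have h2 : Tendsto (fun n => ∫ t in (0 : ℝ)..T,
        Real.exp (-ρ * t) * (c * state F x₀ (y n) t ^ 2)) atTop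
        (𝓝 (∫ t in (0 : ℝ)..T, Real.exp (-ρ * t) * (c * state F x₀ v t ^ 2))) := by
      refine intervalIntegral.tendsto_integral_filter_of_dominated_convergence
        (fun _ => c * (x₀ + |b| * T) ^ 2) (Eventually.of_forall fun n => ?_) ?_
        intervalIntegrable_const (Eventually.of_forall fun t ht => ?_)
      · have := (hcost _ (hy n) T hT).aestronglyMeasurable
        rwa [uIoc_of_le hT.le]
      · filter_upwards [hyb] with n hn
        refine Eventually.of_forall fun t ht => ?_
        rw [uIoc_of_le hT.le] at ht
        have h3 : ∫ s in (0 : ℝ)..t, y n s ≤ |b| * T := by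
          have h4 : ∫ s in (0 : ℝ)..t, y n s ≤ ∫ s in (0 : ℝ)..t, |b| := by
            apply intervalIntegral.integral_mono_ae_restrict ht.1.le
              (admissible_intervalIntegrable (hy n) le_rfl ht.1.le) intervalIntegrable_const
            filter_upwards [ae_restrict_of_ae_restrict_of_subset (Icc_subset_Icc_right ht.2) hn]
              with r hr using hr.trans (le_abs_self b)
          rw [intervalIntegral.integral_const, sub_zero, smul_eq_mul] at h4
          nlinarith [abs_nonneg b, ht.2]
        have h5 : state F x₀ (y n) t ^ 2 ≤ (x₀ + |b| * T) ^ 2 :=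
          pow_le_pow_left₀ (state_nonneg hF hx₀ (hy n) ht.1.le)
            ((state_le hF hx₀ (hy n) ht.1.le).trans (by linarith)) 2
        have h6 : Real.exp (-ρ * t) ≤ 1 := Real.exp_le_one_iff.2 (by nlinarith [ht.1])
        rw [Real.norm_of_nonneg (by positivity)]
        calc Real.exp (-ρ * t) * (c * state F x₀ (y n) t ^ 2) ≤
            1 * (c * (x₀ + |b| * T) ^ 2) := by gcongr
          _ = _ := one_mul _
      · rw [uIoc_of_le hT.le] at ht
        have h3 := tendsto_state hF hx₀ hy hvA hyb (hab.mono fun t ht => ht.1.2) (hv T hT)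
          (Ioc_subset_Icc_self ht)
        exact ((h3.pow 2).const_mul c).const_mul _
    have h3 : V - C * Real.exp (-ρ * T) ≤ (∫ t in (0 : ℝ)..T, f t * Real.exp (-ρ * t)) -
        ∫ t in (0 : ℝ)..T, Real.exp (-ρ * t) * (c * state F x₀ v t ^ 2) := by
      have h4 : Tendsto (fun n => (objective F ρ c x₀ (y n)).toReal) atTop (𝓝 V) := by
        have := (EReal.tendsto_toReal (value_ne_top hF hρ hc hx₀)
          (value_ne_bot hF hρ hc hx₀)).comp hobj
        rwa [hV, EReal.toReal_coe] at this
      have hbot : ∀ᶠ n in atTop, ⊥ < objective F ρ c x₀ (y n) :=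
        hobj.eventually (lt_mem_nhds (bot_lt_iff_ne_bot.2 (value_ne_bot hF hρ hc hx₀)))
      refine le_of_tendsto_of_tendsto (h4.sub_const _) (h1.sub h2) ?_
      filter_upwards [hbot, (hf T hT).1] with n hn hlog
      have hi := integrableOn_payoff hF hρ hc hx₀ (hy n) hn
      obtain ⟨G, hG1, hG2, hG3⟩ := hG _ (hy n)
      rw [objective_eq_integral hi, EReal.toReal_coe]
      have h5 : (∫ t in (0 : ℝ)..T, Real.log (y n t) * Real.exp (-ρ * t)) -
          ∫ t in (0 : ℝ)..T, Real.exp (-ρ * t) * (c * state F x₀ (y n) t ^ 2) =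
          ∫ t in (0 : ℝ)..T, payoff F ρ c x₀ (y n) t := by
        rw [← intervalIntegral.integral_sub _ (hcost _ (hy n) T hT)]
        · refine intervalIntegral.integral_congr fun t _ => ?_
          simp only [payoff]
          ring
        · exact ((intervalIntegrable_iff_integrableOn_Icc_of_le hT.le).2 hlog).mul_continuousOn
            hcont.continuousOn
      have h6 : ∫ t in Ioi 0, payoff F ρ c x₀ (y n) t =
          (∫ t in (0 : ℝ)..T, payoff F ρ c x₀ (y n) t) +
            ∫ t in Ioi T, payoff F ρ c x₀ (y n) t := by
        rw [intervalIntegral.integral_of_le hT.le, ← setIntegral_union Ioc_disjoint_Ioi_same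
          measurableSet_Ioi (hi.mono_set Ioc_subset_Ioi_self)
          (hi.mono_set (Ioi_subset_Ioi hT.le)), Ioc_union_Ioi_eq_Ioi hT.le]
      have h7 : ∫ t in Ioi T, payoff F ρ c x₀ (y n) t ≤ ∫ t in Ioi T, G t :=
        integral_mono_ae (hi.mono_set (Ioi_subset_Ioi hT.le))
          (hG2.mono_set (Ioi_subset_Ioi hT.le)) (ae_restrict_of_ae_restrict_of_subset
          (Ioi_subset_Ioi hT.le) (hG1.mono fun t ht => ht.2))
      rw [h5, h6]
      linarith [hG3 T hT.le]
    refine h3.trans ?_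
    rw [← intervalIntegral.integral_sub ((hfi T hT).mul_continuousOn hcont.continuousOn)
      (hcost _ hvA T hT)]
    refine intervalIntegral.integral_mono_on hT.le (((hfi T hT).mul_continuousOn
      hcont.continuousOn).sub (hcost _ hvA T hT)) (hpayi T hT) fun t ht => ?_
    have h4 : state F x₀ (fun t => Real.exp (f t)) t ≤ state F x₀ v t :=
      (state_mono hF hx₀ hvA huA ht.1
        (ae_restrict_of_ae_restrict_of_subset (Icc_subset_Icc_right ht.2) (huv T hT))).1
    have h5 : Real.exp (-ρ * t) * (c * state F x₀ (fun t => Real.exp (f t)) t ^ 2) ≤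
        Real.exp (-ρ * t) * (c * state F x₀ v t ^ 2) := by
      have := state_nonneg hF hx₀ huA ht.1
      gcongr
    simp only [payoff, Real.log_exp]
    linarith
  obtain ⟨G, hG1, hG2, hG3⟩ := hG _ huA
  have hG0 := hG3 0 le_rfl
  rw [mul_zero, Real.exp_zero, mul_one] at hG0
  -- `G` minus the payoff is nonnegative with bounded integrals over `[0, T]`, by `hmain`
  have hint : IntegrableOn (payoff F ρ c x₀ (fun t => Real.exp (f t))) (Ioi 0) := by
    have hGT : ∀ T, 0 ≤ T → IntervalIntegrable G volume 0 T := fun T hT =>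
      (intervalIntegrable_iff_integrableOn_Ioc_of_le hT).2 (hG2.mono_set Ioc_subset_Ioi_self)
    have h1 := integrableOn_Ioi_of_forall_intervalIntegral_le
      (g := fun t => G t - payoff F ρ c x₀ (fun t => Real.exp (f t)) t) (a := 0)
      (C := C + |V| + C) (hG1.mono fun t ht => sub_nonneg.2 ht.2) (fun T hT => ?_) fun T hT => ?_
    · refine (hG2.sub h1.1).congr (Eventually.of_forall fun t => ?_)
      simp
    · rcases hT.eq_or_lt with rfl | hT
      · exact IntervalIntegrable.refl
      · exact (hGT T hT.le).sub (hpayi T hT)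
    · rcases hT.eq_or_lt with rfl | hT
      · simp only [intervalIntegral.integral_same]
        positivity
      rw [intervalIntegral.integral_sub (hGT T hT.le) (hpayi T hT),
        intervalIntegral.integral_of_le hT.le]
      have h2 : ∫ t in Ioc 0 T, G t ≤ ∫ t in Ioi 0, G t :=
        setIntegral_mono_set hG2 (hG1.mono fun t ht => ht.1) Ioc_subset_Ioi_self.eventuallyLE
      have h3 := hmain T hT
      have h4 : C * Real.exp (-ρ * T) ≤ C :=
        mul_le_of_le_one_right hC (Real.exp_le_one_iff.2 (by nlinarith))
      linarith [neg_abs_le V]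
  refine ⟨⟨huA, hint, le_antisymm (objective_le_value huA) ?_⟩, hbdd⟩
  rw [objective_eq_integral hint, hV, EReal.coe_le_coe_iff]
  have h1 : Tendsto (fun T => V - C * Real.exp (-ρ * T)) atTop (𝓝 V) := by
    have h2 : Tendsto (fun T : ℝ => Real.exp (-ρ * T)) atTop (𝓝 0) :=
      Real.tendsto_exp_atBot.comp (tendsto_id.const_mul_atTop_of_neg (neg_lt_zero.2 hρ))
    simpa using (h2.const_mul C).const_sub V
  refine le_of_tendsto_of_tendsto h1 (intervalIntegral_tendsto_integral_Ioi 0 hint tendsto_id) ?_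
  filter_upwards [eventually_gt_atTop 0] with T hT using hmain T hT

lemma IsFirstDiagonal.isOptimal {F : ℝ → ℝ} (hF : IsLakeDrift F) {ρ c x₀ : ℝ} (hρ : 0 < ρ)
    (hc : 0 < c) (hx₀ : 0 ≤ x₀) {N η : ℝ → ℝ} (hP : IsLocalizationPair F ρ c x₀ N η)
    {u : ℕ → ℝ → ℝ} {w ubar : ℕ → ℕ → ℝ → ℝ} {σ : ℕ → ℕ → ℕ} {v : ℝ → ℝ}
    (h : IsFirstDiagonal F ρ c x₀ N η u w ubar σ v) {τ : ℕ → ℕ} {f : ℝ → ℝ}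
    (hf : IsSecondDiagonal (fun n => ubar n n) τ f) :
    IsOptimal F ρ c x₀ (fun t => Real.exp (f t)) ∧
      LocallyEssBounded (fun t => Real.exp (f t)) := by
  have hτ := hf.1.tendsto_atTop
  refine isOptimal_exp_of_weakTendstoL1 hF hρ hc hx₀ (y := fun n => ubar (τ n) (τ n)) (v := v)
    (fun n => (h.exists_objective_le _ _).1) (h.tendsto_objective.comp hτ) (fun T _ => ?_)
    (fun T _ => ?_) hf.2
  · obtain ⟨k, hk⟩ := exists_nat_ge T
    refine ⟨η (k + 1), N (k + 1), hP.lower_pos _ (by positivity), ?_⟩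
    filter_upwards [hτ.eventually_ge_atTop (k + 1)] with n hn
    obtain ⟨m, -, hae⟩ := h.exists_diagonal_ae_eq hP hn
    have hsub : Icc 0 T ⊆ Icc (0 : ℝ) (k + 1) := Icc_subset_Icc_right (by linarith)
    exact (ae_restrict_of_ae_restrict_of_subset hsub hae).mono fun t ht => ht.2
  · obtain ⟨k, hk⟩ := exists_nat_ge T
    exact ((h.weakTendstoL1_diagonal hP k).comp hτ).mono (by linarith)

end ShallowLake

theorem mainTheorem1 (F : ℝ → ℝ) (hF : ShallowLake.IsLakeDrift F)
    (ρ c x₀ : ℝ) (hρ : 0 < ρ) (hc : 0 < c) (hx₀ : 0 ≤ x₀) :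
    -- the state is well defined and the value is finite
    (∀ u ∈ ShallowLake.Admissible,
      ShallowLake.IsTrajectory F x₀ u (ShallowLake.state F x₀ u) ∧
        ∀ y : ℝ → ℝ, ShallowLake.IsTrajectory F x₀ u y →
          Set.EqOn y (ShallowLake.state F x₀ u) (Set.Ici 0)) ∧
    ShallowLake.value F ρ c x₀ ≠ ⊥ ∧ ShallowLake.value F ρ c x₀ ≠ ⊤ ∧
    -- the two diagonal procedures can be carried out
    (∃ N η : ℝ → ℝ, ShallowLake.IsLocalizationPair F ρ c x₀ N η) ∧
    (∃ u : ℕ → ℝ → ℝ, ShallowLake.IsMaximizing F ρ c x₀ u ∧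
      ∀ n, ShallowLake.value F ρ c x₀ - 1 < ShallowLake.objective F ρ c x₀ (u n)) ∧
    ∀ N η : ℝ → ℝ, ShallowLake.IsLocalizationPair F ρ c x₀ N η →
      ∀ u : ℕ → ℝ → ℝ, ShallowLake.IsMaximizing F ρ c x₀ u →
        (∀ n, ShallowLake.value F ρ c x₀ - 1 < ShallowLake.objective F ρ c x₀ (u n)) →
        (∃ (w ubar : ℕ → ℕ → ℝ → ℝ) (σ : ℕ → ℕ → ℕ) (v : ℝ → ℝ),
          ShallowLake.IsFirstDiagonal F ρ c x₀ N η u w ubar σ v) ∧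
        ∀ (w ubar : ℕ → ℕ → ℝ → ℝ) (σ : ℕ → ℕ → ℕ) (v : ℝ → ℝ),
          ShallowLake.IsFirstDiagonal F ρ c x₀ N η u w ubar σ v →
            (∃ (τ : ℕ → ℕ) (f : ℝ → ℝ),
              ShallowLake.IsSecondDiagonal (fun n => ubar n n) τ f) ∧
            -- every control they produce is optimal and locally bounded
            ∀ (τ : ℕ → ℕ) (f : ℝ → ℝ),
              ShallowLake.IsSecondDiagonal (fun n => ubar n n) τ f →
                ShallowLake.IsOptimal F ρ c x₀ (fun t => Real.exp (f t)) ∧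
                  ShallowLake.LocallyEssBounded (fun t => Real.exp (f t)) := by
  refine ⟨fun u hu => ⟨ShallowLake.isTrajectory_state hF hx₀ hu, fun y hy =>
    ShallowLake.IsTrajectory.eqOn hF hu hy (ShallowLake.isTrajectory_state hF hx₀ hu)⟩,
    ShallowLake.value_ne_bot hF hρ hc hx₀, ShallowLake.value_ne_top hF hρ hc hx₀,
    ShallowLake.exists_isLocalizationPair hF hρ hc hx₀,
    ShallowLake.exists_isMaximizing hF hρ hc hx₀, fun N η hP u hu hlt =>
    ⟨ShallowLake.exists_isFirstDiagonal hP hu hlt, fun w ubar σ v h =>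
    ⟨ShallowLake.exists_isSecondDiagonal hP h, fun τ f hf => h.isOptimal hF hρ hc hx₀ hP hf⟩⟩⟩
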